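/- Graphs are simple and may be infinite; $\mathbb{N}$ contains $0$. \textbf{Definitions.} Let $G=(V,E)$ be a connected graph. A \emph{cut} of $G$ is an edge set $E(A,V\setminus A)$ with $A$ and $V\setminus A$ non-empty; $A$ and $V\setminus A$ are its \emph{sides}, its number of edges is its \emph{order}, and it is a \emph{bond} if both sides induce connected subgraphs. Two cuts are \emph{nested} if some side of one is included in some side of the other; a set of cuts is nested if its elements are pairwise nested. The \emph{ends} of $G$ are the classes of rays (one-way infinite paths) of $G$, where two rays are equivalent if for every finite $S\subseteq V$ they have tails in the same component of $G-S$. Let $\hat V$ be the disjoint union of $V$ and the set of ends of $G$. For $F\subseteq E$, a set $X\subseteq\hat V$ \emph{lives in} a component $C$ of $G-F$ if all vertices in $X$ lie in $C$ and all rays of ends in $X$ have tails in $C$. The set $F$ \emph{distinguishes} $X,Y\subseteq \hat V$ if they live in distinct components of $G-F$, and does so \emph{efficiently} if no edge set of smaller size distinguishes them. For $k\in\mathbb{N}\cup\{\infty\}$, the \emph{$k$-edge-blocks} of $G$ are the classes of the equivalence relation on $\hat V$ in which $x,y$ are equivalent if no set of fewer than $k$ edges (of finitely many, if $k=\infty$)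 distinguishes $\{x\}$ and $\{y\}$. An \emph{edge-block} is a $k$-edge-block for some $k\in\mathbb{N}\cup\{\infty\}$. A set $N$ of bonds \emph{efficiently distinguishes all the edge-blocks} of $G$ if every two disjoint edge-blocks of $G$ are efficiently distinguished by some bond in $N$. A \emph{tree-cut decomposition} of $G$ is a pair $(T,(X_t)_{t\in T})$ of a tree $T$ and pairwise disjoint, possibly empty sets $X_t\subseteq V$ with union $V$, indexed by the nodes of $T$, such that every edge of $T$ lies on a path in $T$ between two nodes with non-empty parts $X_t$. Its \emph{fundamental cuts} are the cuts $E(\bigcup_{t\in T_1}X_t,\bigcup_{t\in T_2}X_t)$, one for every edge $t_1t_2$ of $T$, where $T_1,T_2$ are the components of $T-t_1t_2$. It \emph{decomposes $G$ into its $k$-edge-blocks} if its non-empty parts are precisely the non-empty sets of the form $\beta\cap V$ with $\beta$ a $k$-edge-block of $G$. \textbf{Theorem.} (1) Let $G$ be a connected graph and $k\in\mathbb{N}$. Every nested set of bonds of $G$ of order less than $k$ is the set of fundamental cuts of some tree-cut decomposition of $G$. (2) In particular, let $G$ be a connected graph and let $N$ be any nested set of bonds of $G$ that efficiently distinguishes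 all the edge-blocks of $G$. Then, for every $k\in\mathbb{N}$, the set $N_k$ of all bonds in $N$ of order less than $k$ is the set of fundamental cuts of a tree-cut decomposition of $G$ that decomposes $G$ into its $k$-edge-blocks. (3) One can choose for every connected graph $G$ a nested set $N(G)$ of bonds of $G$ that efficiently distinguishes all the edge-blocks of $G$ (so that (2) applies to $N=N(G)$ and every $k\in\mathbb{N}$) in a canonical way: $\varphi(N(G))=N(H)$ for every isomorphism $\varphi\colon G\to H$ between connected graphs. -/

import Mathlib

universe u

namespace EdgeBlocks

/-! ### Rays and ends -/

section Ends

variable {V : Type u}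

/-- A ray of `G`: a one-way infinite path. -/
structure Ray (G : SimpleGraph V) where
  vertex : ℕ → V
  injective : Function.Injective vertex
  adj : ∀ n, G.Adj (vertex n) (vertex (n + 1))

/-- Two rays are equivalent if, for every finite set `S` of vertices, they have tails in the same
component of `G - S`. -/
def Ray.Equivalent {G : SimpleGraph V} (R R' : Ray G) : Prop :=
  ∀ S : Set V, S.Finite → ∃ C : G.ComponentCompl S,
    (∃ n, ∀ i, n ≤ i → R.vertex i ∈ C) ∧ (∃ n, ∀ i, n ≤ i → R'.vertex i ∈ C)

theorem Ray.Equivalent.refl {G : SimpleGraph V} (R : Ray G) : R.Equivalent R := by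
  intro S hS
  have hfin : {i | R.vertex i ∈ S}.Finite := hS.preimage R.injective.injOn
  obtain ⟨m, hm⟩ := hfin.bddAbove
  have hout : ∀ i, m + 1 ≤ i → R.vertex i ∉ S := by
    intro i hi h
    have := hm h
    omega
  have key : ∀ i, m + 1 ≤ i → R.vertex i ∈ G.componentComplMk (hout (m + 1) le_rfl) := by
    intro i hi
    induction i, hi using Nat.le_induction with
    | base => exact G.componentComplMk_mem _
    | succ i hi ih =>
      exact SimpleGraph.ComponentCompl.mem_of_adj _ _ ih (hout (i + 1) (by omega)) (R.adj i)
  exact ⟨_, ⟨m + 1, key⟩, ⟨m + 1, key⟩⟩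

theorem Ray.Equivalent.symm {G : SimpleGraph V} {R R' : Ray G} (h : R.Equivalent R') :
    R'.Equivalent R := fun S hS =>
  let ⟨C, h₁, h₂⟩ := h S hS
  ⟨C, h₂, h₁⟩

theorem Ray.Equivalent.trans {G : SimpleGraph V} {R R' R'' : Ray G} (h : R.Equivalent R')
    (h' : R'.Equivalent R'') : R.Equivalent R'' := by
  intro S hS
  obtain ⟨C, h₁, n, h₂⟩ := h S hS
  obtain ⟨D, ⟨m, h₃⟩, h₄⟩ := h' S hS
  obtain ⟨_, hC⟩ := h₂ (max n m) (le_max_left _ _)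
  obtain ⟨_, hD⟩ := h₃ (max n m) (le_max_right _ _)
  have hCD : C = D := hC.symm.trans hD
  exact ⟨C, h₁, hCD ▸ h₄⟩

instance raySetoid (G : SimpleGraph V) : Setoid (Ray G) where
  r := Ray.Equivalent
  iseqv := ⟨Ray.Equivalent.refl, Ray.Equivalent.symm, Ray.Equivalent.trans⟩

/-- The ends (vertex-ends) of `G`: the equivalence classes of its rays. -/
def Ends (G : SimpleGraph V) : Type u := Quotient (raySetoid G)

/-- The end that contains the ray `R`. -/
def Ray.toEnd {G : SimpleGraph V} (R : Ray G) : Ends G := Quotient.mk (raySetoid G) R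

/-- The disjoint union of the vertices and the ends of `G`. -/
abbrev Point (G : SimpleGraph V) : Type u := V ⊕ Ends G

end Ends

/-! ### Edge-blocks -/

section Blocks

variable {V : Type u} (G : SimpleGraph V)

/-- The set `X` of vertices and ends lives in the component `C` of `G - F`: the vertices in `X` lie
in `C`, and every ray of every end in `X` has a tail in the subgraph `C`. -/
def LivesIn (F : Set (Sym2 V)) (X : Set (Point G)) (C : (G.deleteEdges F).ConnectedComponent) :
    Prop :=
  (∀ v : V, Sum.inl v ∈ X → v ∈ C.supp) ∧
    ∀ R : Ray G, Sum.inr R.toEnd ∈ X → ∃ n, ∀ i, n ≤ i →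
      R.vertex i ∈ C.supp ∧ (G.deleteEdges F).Adj (R.vertex i) (R.vertex (i + 1))

/-- The edge set `F` distinguishes `X` and `Y`: they live in distinct components of `G - F`. -/
def Distinguishes (F : Set (Sym2 V)) (X Y : Set (Point G)) : Prop :=
  F ⊆ G.edgeSet ∧ ∃ C D : (G.deleteEdges F).ConnectedComponent,
    C ≠ D ∧ LivesIn G F X C ∧ LivesIn G F Y D

/-- `F` distinguishes `X` and `Y`, and no edge set of smaller size does. -/
def DistinguishesEfficiently (F : Set (Sym2 V)) (X Y : Set (Point G)) : Prop :=
  Distinguishes G F X Y ∧ ∀ F' : Set (Sym2 V), Distinguishes G F' X Y → F.encard ≤ F'.encard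

/-- `x` and `y` cannot be separated by fewer than `k` edges (by finitely many, if `k = ∞`). -/
def Inseparable (k : ℕ∞) (x y : Point G) : Prop :=
  ∀ F : Set (Sym2 V), F.encard < k → ¬ Distinguishes G F {x} {y}

/-- The `k`-edge-blocks: the equivalence classes of `(< k)`-inseparability. -/
def IsKEdgeBlock (k : ℕ∞) (β : Set (Point G)) : Prop :=
  ∃ x : Point G, β = {y | Inseparable G k x y}

/-- An edge-block is a `k`-edge-block for some `k ∈ ℕ ∪ {∞}`. -/
def IsEdgeBlock (β : Set (Point G)) : Prop := ∃ k : ℕ∞, IsKEdgeBlock G k β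

end Blocks

/-! ### Cuts, bonds and nestedness -/

section Cuts

variable {V : Type u} (G : SimpleGraph V)

/-- `F` is a cut with sides `A` and `Aᶜ`. -/
def IsCutWithSide (F : Set (Sym2 V)) (A : Set V) : Prop :=
  A.Nonempty ∧ Aᶜ.Nonempty ∧ F = (G.between A Aᶜ).edgeSet

/-- A bond is a cut with connected sides. -/
def IsBond (F : Set (Sym2 V)) : Prop :=
  ∃ A : Set V, IsCutWithSide G F A ∧ (G.induce A).Connected ∧ (G.induce Aᶜ).Connected

/-- Two cuts are nested if some side of the one is included in some side of the other. -/
def Nested (F F' : Set (Sym2 V)) : Prop :=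
  ∃ A A' : Set V, IsCutWithSide G F A ∧ IsCutWithSide G F' A' ∧ A ⊆ A'

/-- `B` is a set of bonds of `G` that are pairwise nested. -/
def IsNestedSetOfBonds (B : Set (Set (Sym2 V))) : Prop :=
  (∀ F ∈ B, IsBond G F) ∧ ∀ F ∈ B, ∀ F' ∈ B, Nested G F F'

/-- Every two disjoint edge-blocks of `G` are distinguished efficiently by an element of `B`. -/
def EfficientlyDistinguishesEdgeBlocks (B : Set (Set (Sym2 V))) : Prop :=
  ∀ β β' : Set (Point G), IsEdgeBlock G β → IsEdgeBlock G β' → Disjoint β β' →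
    ∃ F ∈ B, DistinguishesEfficiently G F β β'

end Cuts

/-- The elements of `B` of order less than `k`. -/
def orderLT {V : Type u} (B : Set (Set (Sym2 V))) (k : ℕ) : Set (Set (Sym2 V)) :=
  {F | F ∈ B ∧ F.encard < k}

/-- The image of a set of edge sets under a map of the vertices. -/
def mapCuts {V W : Type u} (φ : V → W) (B : Set (Set (Sym2 V))) : Set (Set (Sym2 W)) :=
  (fun F => Sym2.map φ '' F) '' B

/-! ### Tree-cut decompositions -/

/-- A tree-cut decomposition of `G`: a tree with a near-partition of `V(G)` into parts indexed by
its nodes, such that every edge of the tree lies on a path of the tree between two nodes with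
non-empty parts. -/
structure TreeCutDecomposition {V : Type u} (G : SimpleGraph V) where
  Node : Type u
  tree : SimpleGraph Node
  isTree : tree.IsTree
  part : Node → Set V
  disjoint : ∀ s t, s ≠ t → Disjoint (part s) (part t)
  cover : ⋃ t, part t = Set.univ
  dense : ∀ s t, tree.Adj s t → ∃ a b : Node, (part a).Nonempty ∧ (part b).Nonempty ∧
    ∃ p : tree.Walk a b, p.IsPath ∧ s(s, t) ∈ p.edges

namespace TreeCutDecomposition

variable {V : Type u} {G : SimpleGraph V} (D : TreeCutDecomposition G)

/-- The union of the parts at the nodes of the component of `T - st` that contains `s`. -/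
def side (s t : D.Node) : Set V :=
  {v | ∃ r, (D.tree.deleteEdges {s(s, t)}).Reachable s r ∧ v ∈ D.part r}

/-- The set of cuts of `G` that are induced by the edges of the tree. -/
def fundamentalCuts : Set (Set (Sym2 V)) :=
  {F | ∃ s t, D.tree.Adj s t ∧ F = (G.between (D.side s t) (D.side t s)).edgeSet}

/-- The non-empty parts are the (non-empty) sets of vertices of the `k`-edge-blocks of `G`; a
`k`-edge-block that consists of ends only has no vertices and contributes no part. -/
def DecomposesIntoKEdgeBlocks (k : ℕ∞) : Prop :=
  ∀ P : Set V, P.Nonempty →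
    ((∃ t, D.part t = P) ↔ ∃ β, IsKEdgeBlock G k β ∧ {v : V | Sum.inl v ∈ β} = P)

end TreeCutDecomposition

end EdgeBlocks

/-! Parts (1) and (2): a nested set of bonds is turned into a tree by orienting it. Only finitely
many bonds of bounded order separate two given vertices (`finite_bondSides_separating`), so the
orientations of the bonds induced by vertices pairwise differ finitely. The nodes of the tree are
all consistent orientations with this finiteness property, and an edge is the flip of a single side.
Flipping minimal sides one at a time connects any two nodes (`reachable_of_flips`). A given side is
flipped by one edge only (`IsFlip.eq`), so every edge is a bridge and induces exactly the cut it
flips (`mem_iff_mem_of_reachable`). The non-empty parts are the classes of vertices that the bonds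
do not separate. If the bonds come from a set that efficiently distinguishes all the edge-blocks,
those of order less than `k` separate two vertices exactly when these lie in different
`k`-edge-blocks (`inseparable_vertices_iff`).

Part (3): the canonical set is built by increasing order `k`. The candidates are the minimum
separators of order `k`, of any two vertices or rays, that are nested with everything selected
before. Submodularity uncrosses a minimum separator from smaller ones, so a candidate exists for
every pair that needs one (`exists_candidate`). For every pair, all candidates crossed by the fewest
candidates are selected. The number of crossings is finite and strictly submodular on crossing
candidates (`ncard_crossing_inter_add_union_lt`), hence selected sides never cross
(`MinCandidate.nestedSides`). Since all minimisers are taken, nothing is chosen and isomorphisms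
preserve the result. -/

namespace EdgeBlocks

/-! ### Cuts and linked vertex sets -/

section CutBasics

variable {V : Type u} {G : SimpleGraph V} {A B D : Set V}

/-- The edges between `A` and its complement. -/
def cut (G : SimpleGraph V) (A : Set V) : Set (Sym2 V) := (G.between A Aᶜ).edgeSet

theorem mem_cut {a b : V} : s(a, b) ∈ cut G A ↔ G.Adj a b ∧ ¬ (a ∈ A ↔ b ∈ A) := by
  simp only [cut, SimpleGraph.mem_edgeSet, SimpleGraph.between_adj, Set.mem_compl_iff]
  tauto

theorem cut_subset_edgeSet : cut G A ⊆ G.edgeSet := by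
  intro e
  induction e with
  | _ a b => exact fun h => (mem_cut.1 h).1

theorem cut_compl : cut G Aᶜ = cut G A := by
  ext e
  induction e with
  | _ a b => simp only [mem_cut, Set.mem_compl_iff]; tauto

theorem exists_adj_of_reachable {v w : V} (h : G.Reachable v w) (hv : v ∈ A) (hw : w ∉ A) :
    ∃ a ∈ A, ∃ b ∉ A, G.Adj a b := by
  obtain ⟨p⟩ := h
  obtain ⟨d, -, h₁, h₂⟩ := p.exists_boundary_dart A hv hw
  exact ⟨d.fst, h₁, d.snd, h₂, d.adj⟩

theorem cut_nonempty (hG : G.Connected) (hA : A.Nonempty) (hA' : Aᶜ.Nonempty) :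
    (cut G A).Nonempty := by
  obtain ⟨v, hv⟩ := hA
  obtain ⟨w, hw⟩ := hA'
  obtain ⟨a, ha, b, hb, hab⟩ := exists_adj_of_reachable (hG v w) hv hw
  exact ⟨s(a, b), mem_cut.2 ⟨hab, by tauto⟩⟩

/-- An edge in either corner cut lies in one of the two cuts, and an edge in both corner cuts lies
in both. -/
theorem cut_inter_union_submodular :
    (cut G (A ∩ B)).encard + (cut G (A ∪ B)).encard ≤ (cut G A).encard + (cut G B).encard := by
  rw [← Set.encard_union_add_encard_inter, ← Set.encard_union_add_encard_inter (cut G A)]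
  refine add_le_add (Set.encard_le_encard ?_) (Set.encard_le_encard ?_) <;> intro e <;>
    induction e with
    | _ a b =>
      simp only [mem_cut, Set.mem_union, Set.mem_inter_iff]
      tauto

/-- The set of vertices on which `A` and `B` agree is closed under adjacency, hence empty or
everything. -/
theorem cut_eq_cut (hG : G.Connected) (h : cut G A = cut G B) : B = A ∨ B = Aᶜ := by
  have key : ∀ a b, G.Adj a b → ((a ∈ A ↔ a ∈ B) ↔ (b ∈ A ↔ b ∈ B)) := by
    intro a b hab
    have := Set.ext_iff.1 h s(a, b)
    rw [mem_cut, mem_cut] at this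
    tauto
  by_contra! hne
  obtain ⟨h₁, h₂⟩ := hne
  have e₁ : ∃ v, ¬ (v ∈ A ↔ v ∈ B) := by
    by_contra! hh
    exact h₁ (Set.ext fun v => by have := hh v; tauto)
  have e₂ : ∃ v, (v ∈ A ↔ v ∈ B) := by
    by_contra! hh
    exact h₂ (Set.ext fun v => by have := hh v; simp only [Set.mem_compl_iff]; tauto)
  obtain ⟨v, hv⟩ := e₂
  obtain ⟨w, hw⟩ := e₁
  obtain ⟨a, ha, b, hb, hab⟩ :=
    exists_adj_of_reachable (A := {v | v ∈ A ↔ v ∈ B}) (hG v w) hv hw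
  exact hb ((key a b hab).1 ha)

/-- No bipartition of `A` into two non-empty sets is without an edge of `G`. -/
def Linked (G : SimpleGraph V) (A : Set V) : Prop :=
  ∀ B : Set V, (A ∩ B).Nonempty → (A \ B).Nonempty → ∃ a ∈ A ∩ B, ∃ b ∈ A \ B, G.Adj a b

theorem linked_of_connected_induce (h : (G.induce A).Connected) : Linked G A := by
  rintro B ⟨a, ha, haB⟩ ⟨b, hb, hbB⟩
  obtain ⟨x, hx, y, hy, hxy⟩ := exists_adj_of_reachable (A := {z : A | (z : V) ∈ B})
    (h ⟨a, ha⟩ ⟨b, hb⟩) haB hbB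
  exact ⟨x, ⟨x.2, hx⟩, y, ⟨y.2, hy⟩, hxy⟩

theorem Linked.connected_induce (h : Linked G A) (hA : A.Nonempty) : (G.induce A).Connected := by
  have : Nonempty A := hA.to_subtype
  refine ⟨fun a b => ?_⟩
  by_contra hab
  obtain ⟨x, ⟨hx, hx', hxr⟩, y, ⟨hy, hyr⟩, hxy⟩ := h {z | ∃ hz : z ∈ A, (G.induce A).Reachable a ⟨z, hz⟩}
    ⟨a, a.2, a.2, SimpleGraph.Reachable.refl _⟩ ⟨b, b.2, fun ⟨_, hb⟩ => hab hb⟩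
  have hadj : (G.induce A).Adj ⟨x, hx⟩ ⟨y, hy⟩ := hxy
  exact hyr ⟨hy, hxr.trans hadj.reachable⟩

/-- Both `A` and its complement are linked. -/
structure IsBondSide (G : SimpleGraph V) (A : Set V) : Prop where
  linked : Linked G A
  linked_compl : Linked G Aᶜ

theorem IsBondSide.compl (h : IsBondSide G A) : IsBondSide G Aᶜ :=
  ⟨h.linked_compl, by rw [compl_compl]; exact h.linked⟩

/-! ### Finiteness of the bonds of bounded order that separate two vertices -/

/-- Every such side cuts some edge `ab` of a fixed walk from `v` to `w`. Deleting `ab` keeps both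
sides linked and lowers the order by one. The graph varies in the induction and need not be
connected. -/
theorem finite_bondSides_separating (k : ℕ) (G : SimpleGraph V) (v w : V)
    (h : G.Reachable v w) :
    {A | v ∈ A ∧ w ∉ A ∧ IsBondSide G A ∧ (cut G A).encard ≤ k}.Finite := by
  induction k generalizing G v w with
  | zero =>
    convert Set.finite_empty
    rw [Set.eq_empty_iff_forall_notMem]
    rintro A ⟨hv, hw, -, hA⟩
    obtain ⟨a, ha, b, hb, hab⟩ := exists_adj_of_reachable h hv hw
    have hmem : s(a, b) ∈ cut G A := mem_cut.2 ⟨hab, by tauto⟩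
    have hA0 : cut G A = ∅ := by simpa using hA
    rw [hA0] at hmem
    exact hmem
  | succ k ih =>
    obtain ⟨p⟩ := h
    refine Set.Finite.subset (Set.Finite.biUnion (List.finite_toSet p.darts)
      (t := fun d => {A | d.fst ∈ A ∧ d.snd ∉ A ∧ IsBondSide G A ∧
        (cut G A).encard ≤ (k + 1 : ℕ)}) ?_) ?_
    · rintro d -
      obtain ⟨⟨a, b⟩, hab⟩ := d
      simp only
      change G.Adj a b at hab
      have hadj : ∀ A : Set V, a ∈ A → b ∉ A → ∀ x y, (x ∈ A ↔ y ∈ A) → G.Adj x y →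
          (G.deleteEdges {s(a, b)}).Adj x y := by
        intro A ha hb x y hxy hadj
        rw [SimpleGraph.deleteEdges_adj]
        refine ⟨hadj, ?_⟩
        simp only [Set.mem_singleton_iff, Sym2.eq_iff]
        rintro (⟨rfl, rfl⟩ | ⟨rfl, rfl⟩) <;> tauto
      by_cases hr : (G.deleteEdges {s(a, b)}).Reachable a b
      · refine (ih _ _ _ hr).subset ?_
        rintro A ⟨ha, hb, hA, hk⟩
        refine ⟨ha, hb, ⟨?_, ?_⟩, ?_⟩
        · intro B h₁ h₂
          obtain ⟨x, hx, y, hy, hxy⟩ := hA.linked B h₁ h₂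
          exact ⟨x, hx, y, hy, hadj A ha hb x y (iff_of_true hx.1 hy.1) hxy⟩
        · intro B h₁ h₂
          obtain ⟨x, hx, y, hy, hxy⟩ := hA.linked_compl B h₁ h₂
          exact ⟨x, hx, y, hy, hadj A ha hb x y (iff_of_false hx.1 hy.1) hxy⟩
        · have hsub : cut (G.deleteEdges {s(a, b)}) A ⊆ cut G A \ {s(a, b)} := by
            intro e
            induction e with
            | _ x y =>
              simp only [mem_cut, SimpleGraph.deleteEdges_adj, Set.mem_sdiff]
              tauto
          have hmem : s(a, b) ∈ cut G A := mem_cut.2 ⟨hab, by tauto⟩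
          have h1 := Set.encard_sdiff_singleton_add_one hmem
          have h2 := Set.encard_le_encard hsub
          rw [← h1] at hk
          push_cast at hk
          exact h2.trans ((ENat.add_le_add_iff_right (by simp)).1 hk)
      -- When `ab` is a bridge, the only possible side is the component of `a` after its deletion.
      · refine (Set.finite_singleton {x | (G.deleteEdges {s(a, b)}).Reachable a x}).subset ?_
        rintro A ⟨ha, hb, hA, -⟩
        have h₁ : A ⊆ {x | (G.deleteEdges {s(a, b)}).Reachable a x} := by
          intro z hz
          by_contra hzr
          obtain ⟨x, hx, y, hy, hxy⟩ := hA.linked {x | (G.deleteEdges {s(a, b)}).Reachable a x}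
            ⟨a, ha, SimpleGraph.Reachable.refl _⟩ ⟨z, hz, hzr⟩
          exact hy.2 (hx.2.trans (hadj A ha hb x y (iff_of_true hx.1 hy.1) hxy).reachable)
        refine Set.mem_singleton_iff.2 (h₁.antisymm ?_)
        intro z hz
        by_contra hzA
        obtain ⟨x, hx, y, hy, hxy⟩ :=
          hA.linked_compl {x | (G.deleteEdges {s(a, b)}).Reachable a x} ⟨z, hzA, hz⟩ ⟨b, hb, hr⟩
        exact hy.2 (hx.2.trans (hadj A ha hb x y (iff_of_false hx.1 hy.1) hxy).reachable)
    · rintro A ⟨hv, hw, hA⟩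
      obtain ⟨d, hd, h₁, h₂⟩ := p.exists_boundary_dart A hv hw
      exact Set.mem_biUnion hd ⟨h₁, h₂, hA⟩

/-! ### Nested sides -/

/-- Some set in `{A, Aᶜ}` is included in some set in `{D, Dᶜ}`. -/
def NestedSides (A D : Set V) : Prop := A ⊆ D ∨ A ⊆ Dᶜ ∨ Aᶜ ⊆ D ∨ Aᶜ ⊆ Dᶜ

theorem nestedSides_compl_left : NestedSides Aᶜ D ↔ NestedSides A D := by
  unfold NestedSides; rw [compl_compl]; tauto

theorem nestedSides_compl_right : NestedSides A Dᶜ ↔ NestedSides A D := by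
  unfold NestedSides; rw [compl_compl]; tauto

theorem NestedSides.symm (h : NestedSides A D) : NestedSides D A := by
  rcases h with h | h | h | h
  · exact Or.inr (Or.inr (Or.inr (Set.compl_subset_compl.2 h)))
  · exact Or.inr (Or.inl (Set.subset_compl_comm.1 h))
  · exact Or.inr (Or.inr (Or.inl (Set.compl_subset_comm.1 h)))
  · exact Or.inl (Set.compl_subset_compl.1 h)

/-- A set nested with two crossing sets is nested with their intersection. -/
theorem NestedSides.inter (hAB : ¬ NestedSides A B) (hA : NestedSides A D)
    (hB : NestedSides B D) : NestedSides (A ∩ B) D := by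
  unfold NestedSides at *
  simp only [Set.subset_def, Set.mem_compl_iff, Set.mem_inter_iff] at *
  grind

theorem NestedSides.union (hAB : ¬ NestedSides A B) (hA : NestedSides A D)
    (hB : NestedSides B D) : NestedSides (A ∪ B) D := by
  rw [← nestedSides_compl_left, Set.compl_union]
  refine NestedSides.inter ?_ (nestedSides_compl_left.2 hA) (nestedSides_compl_left.2 hB)
  rwa [nestedSides_compl_left, nestedSides_compl_right]

/-- A set nested with `A` is nested with one of any two opposite corners of `A` and `B`. -/
theorem NestedSides.inter_or_union (hA : NestedSides A D) :
    NestedSides (A ∩ B) D ∨ NestedSides (A ∪ B) D := by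
  rcases hA with h | h | h | h
  · exact Or.inl (Or.inl (Set.inter_subset_left.trans h))
  · exact Or.inl (Or.inr (Or.inl (Set.inter_subset_left.trans h)))
  · exact Or.inr (Or.inr (Or.inr (Or.inl ((Set.compl_subset_compl.2 Set.subset_union_left).trans h))))
  · exact Or.inr (Or.inr (Or.inr (Or.inr ((Set.compl_subset_compl.2 Set.subset_union_left).trans h))))

theorem finite_endpoints {F : Set (Sym2 V)} (hF : F.Finite) : {z | ∃ e ∈ F, z ∈ e}.Finite := by
  have : {z | ∃ e ∈ F, z ∈ e} = ⋃ e ∈ F, {z | z ∈ e} := by ext; simp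
  rw [this]
  refine hF.biUnion fun e _ => ?_
  induction e with
  | _ a b =>
    refine ((Set.finite_singleton b).insert a).subset fun z hz => ?_
    simpa using hz

/-- If `B` crosses `A`, then both `B` and `Bᶜ` are linked and meet both sides of `A`, so each
contains an edge of the cut of `A`. Hence `B` separates two of the finitely many endpoints of that
cut. -/
theorem finite_crossing_bondSides (hG : G.Connected) (hA : (cut G A).Finite) (k : ℕ) :
    {B | IsBondSide G B ∧ (cut G B).encard ≤ k ∧ ¬ NestedSides A B}.Finite := by
  have hZ := finite_endpoints hA
  refine ((hZ.prod hZ).biUnion (t := fun z : V × V =>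
    {B | z.1 ∈ B ∧ z.2 ∉ B ∧ IsBondSide G B ∧ (cut G B).encard ≤ k})
    fun z _ => finite_bondSides_separating k G z.1 z.2 (hG _ _)).subset ?_
  rintro B ⟨hB, hk, hAB⟩
  by_contra hcon
  have hcon' : ∀ x y, (∃ e ∈ cut G A, x ∈ e) → (∃ e ∈ cut G A, y ∈ e) → x ∈ B → y ∈ B := by
    intro x y hx hy hxB
    by_contra hyB
    exact hcon (Set.mem_biUnion (x := (x, y)) ⟨hx, hy⟩ ⟨hxB, hyB, hB, hk⟩)
  unfold NestedSides at hAB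
  push Not at hAB
  simp only [Set.not_subset, Set.mem_compl_iff, not_not] at hAB
  obtain ⟨⟨a, haA, haB⟩, ⟨b, hbA, hbB⟩, ⟨c, hcA, hcB⟩, ⟨d, hdA, hdB⟩⟩ := hAB
  obtain ⟨x, hx, y, hy, hxy⟩ := hB.linked A ⟨b, hbB, hbA⟩ ⟨d, hdB, hdA⟩
  obtain ⟨x', hx', y', hy', hxy'⟩ := hB.linked_compl A ⟨a, haB, haA⟩ ⟨c, hcB, hcA⟩
  refine hx'.1 (hcon' x x' ⟨_, mem_cut.2 ⟨hxy, ?_⟩, Sym2.mem_mk_left _ _⟩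
    ⟨_, mem_cut.2 ⟨hxy', ?_⟩, Sym2.mem_mk_left _ _⟩ hx.1)
  · exact fun h => hy.2 (h.1 hx.2)
  · exact fun h => hy'.2 (h.1 hx'.2)

end CutBasics

end EdgeBlocks
namespace EdgeBlocks

/-! ### The tree of a nested system of sides -/

section Tree

variable {V : Type u} {E : Set (Set V)}

/-- A set of pairwise nested vertex sets, closed under complements, only finitely many of which
separate any two given vertices. -/
structure IsSideSystem (E : Set (Set V)) : Prop where
  compl_mem : ∀ A ∈ E, Aᶜ ∈ E
  nonempty : ∀ A ∈ E, A.Nonempty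
  nested : ∀ A ∈ E, ∀ D ∈ E, NestedSides A D
  finite : ∀ v w, {A | A ∈ E ∧ v ∈ A ∧ w ∉ A}.Finite

/-- A consistent orientation of `E` that differs only finitely from those induced by vertices. -/
structure IsNode (E : Set (Set V)) (O : Set (Set V)) : Prop where
  subset : O ⊆ E
  mem_iff : ∀ A ∈ E, A ∈ O ↔ Aᶜ ∉ O
  up : ∀ A ∈ O, ∀ D ∈ E, A ⊆ D → D ∈ O
  finite : ∀ v, {A | A ∈ O ∧ v ∉ A}.Finite

/-- The orientation `t` arises from `s` by flipping `A`. -/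
structure IsFlip (A : Set V) (s t : Set (Set V)) : Prop where
  mem : A ∈ s
  compl_mem : Aᶜ ∈ t
  other : ∀ D ∈ s, D ≠ A → D ∈ t

theorem IsNode.compl_notMem {O : Set (Set V)} (hO : IsNode E O) {A : Set V} (hA : A ∈ O) :
    Aᶜ ∉ O := (hO.mem_iff A (hO.subset hA)).1 hA

theorem IsNode.notMem_of_compl {O : Set (Set V)} (hO : IsNode E O) {A : Set V} (hA : Aᶜ ∈ O) :
    A ∉ O := fun h => hO.compl_notMem h hA

theorem IsNode.compl_mem {O : Set (Set V)} (hO : IsNode E O) {A : Set V} (hE : A ∈ E)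
    (hA : A ∉ O) : Aᶜ ∈ O := by
  by_contra h
  exact hA ((hO.mem_iff A hE).2 h)

theorem isNode_vertex (hE : IsSideSystem E) (v : V) : IsNode E {A | A ∈ E ∧ v ∈ A} where
  subset := fun _ h => h.1
  mem_iff := fun A hA => by
    have := hE.compl_mem A hA
    simp only [Set.mem_ofPred_eq, Set.mem_compl_iff]
    tauto
  up := fun A hA D hD h => ⟨hD, h hA.2⟩
  finite := fun w => (hE.finite v w).subset fun _ h => ⟨h.1.1, h.1.2, h.2⟩

/-- The orientation towards the end of the tree edge of `A` on the side of `A`. -/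
theorem isNode_edge (hE : IsSideSystem E) {A : Set V} (hA : A ∈ E) :
    IsNode E {D | D ∈ E ∧ (A ⊆ D ∨ Aᶜ ⊂ D)} := by
  have hne := hE.nonempty A hA
  have hne' := hE.nonempty _ (hE.compl_mem A hA)
  refine ⟨fun _ h => h.1, ?_, ?_, ?_⟩
  -- One inclusion has to be strict: with `Aᶜ ⊆ D` the orientation would contain both `A` and `Aᶜ`.
  · intro D hD
    have hDc := hE.compl_mem D hD
    simp only [Set.mem_ofPred_eq, hD, hDc, true_and]
    constructor
    · rintro (h | h) (h' | h')
      · obtain ⟨a, ha⟩ := hne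
        exact h' ha (h ha)
      · exact h'.2 (Set.compl_subset_compl.2 h)
      · exact h.2 (Set.subset_compl_comm.1 h')
      · obtain ⟨a, ha⟩ := hne'
        exact h'.1 ha (h.1 ha)
    · intro h
      push Not at h
      rcases hE.nested A hA D hD with h' | h' | h' | h'
      · exact Or.inl h'
      · exact absurd h' h.1
      · rcases h'.eq_or_ssubset with h'' | h''
        · refine absurd ?_ h.1
          rw [← h'', compl_compl]
        · exact Or.inr h''
      · rcases h'.eq_or_ssubset with h'' | h''
        · left
          rw [compl_inj_iff.1 h'']
        · exact absurd h'' h.2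
  · rintro B ⟨hB, h⟩ D hD hBD
    exact ⟨hD, h.imp (fun h => h.trans hBD) (fun h => h.trans_subset hBD)⟩
  · intro v
    obtain ⟨w, hw⟩ := hne
    obtain ⟨w', hw'⟩ := hne'
    refine ((hE.finite w v).union (hE.finite w' v)).subset ?_
    rintro D ⟨⟨hD, h | h⟩, hv⟩
    · exact Or.inl ⟨hD, h hw, hv⟩
    · exact Or.inr ⟨hD, h.1 hw', hv⟩

theorem isFlip_edge {A : Set V} (hA : A ∈ E) (hA' : Aᶜ ∈ E) :
    IsFlip A {D | D ∈ E ∧ (A ⊆ D ∨ Aᶜ ⊂ D)} {D | D ∈ E ∧ (Aᶜ ⊆ D ∨ Aᶜᶜ ⊂ D)} where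
  mem := ⟨hA, Or.inl subset_rfl⟩
  compl_mem := ⟨hA', Or.inl subset_rfl⟩
  other := by
    rintro D ⟨hD, h | h⟩ hne
    · refine ⟨hD, Or.inr ?_⟩
      rw [compl_compl]
      exact h.ssubset_of_ne hne.symm
    · exact ⟨hD, Or.inl h.1⟩

theorem IsFlip.symm {s t : Set (Set V)} (hs : IsNode E s) (ht : IsNode E t) {A : Set V}
    (h : IsFlip A s t) : IsFlip Aᶜ t s where
  mem := h.compl_mem
  compl_mem := by rw [compl_compl]; exact h.mem
  other := by
    intro D hD hne
    by_contra hDs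
    have hDE := ht.subset hD
    refine ht.compl_notMem hD (h.other _ (hs.compl_mem hDE hDs) ?_)
    rintro rfl
    exact hne (compl_compl D).symm

theorem IsFlip.mem_iff {s t : Set (Set V)} (hs : IsNode E s) (ht : IsNode E t) {A D : Set V}
    (h : IsFlip A s t) (h₁ : D ≠ A) (h₂ : D ≠ Aᶜ) : D ∈ s ↔ D ∈ t :=
  ⟨fun hD => h.other D hD h₁, fun hD => (h.symm hs ht).other D hD h₂⟩

/-- The flipped side determines the node. Consistency of `s` forces everything above `A` into `s`;
consistency of `t` forces everything above `Aᶜ` into `t`, and all of it except `Aᶜ` survives the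
flip back. The sides so forced already form a full orientation. -/
theorem IsFlip.eq (hE : IsSideSystem E) {s t : Set (Set V)} (hs : IsNode E s) (ht : IsNode E t)
    {A : Set V} (h : IsFlip A s t) : s = {D | D ∈ E ∧ (A ⊆ D ∨ Aᶜ ⊂ D)} := by
  have hA := hs.subset h.mem
  have hn := isNode_edge hE hA
  have hsub : {D | D ∈ E ∧ (A ⊆ D ∨ Aᶜ ⊂ D)} ⊆ s := by
    rintro D ⟨hD, h' | h'⟩
    · exact hs.up A h.mem D hD h'
    · exact (h.symm hs ht).other D (ht.up _ h.compl_mem D hD h'.1) h'.ne'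
  refine Set.Subset.antisymm ?_ hsub
  intro D hD
  rw [hn.mem_iff D (hs.subset hD)]
  exact fun hc => hs.compl_notMem hD (hsub hc)

/-- The tree of a system of sides: two orientations are adjacent if they differ by one flip. -/
def flipTree (E : Set (Set V)) : SimpleGraph {O // IsNode E O} where
  Adj s t := ∃ A, IsFlip A s.1 t.1
  symm := ⟨fun s t ⟨_, h⟩ => ⟨_, h.symm s.2 t.2⟩⟩
  loopless := ⟨fun s ⟨_, h⟩ => s.2.compl_notMem h.mem h.compl_mem⟩

/-! ### The flip graph is a tree -/

theorem finite_diff [Nonempty V] {s t : Set (Set V)} (hs : IsNode E s) (ht : IsNode E t) :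
    {A | A ∈ s ∧ A ∉ t}.Finite := by
  obtain ⟨v⟩ := ‹Nonempty V›
  refine ((hs.finite v).union ((ht.finite v).image compl)).subset ?_
  rintro A ⟨hA, hAt⟩
  by_cases hv : v ∈ A
  · exact Or.inr ⟨Aᶜ, ⟨ht.compl_mem (hs.subset hA) hAt, fun h => h hv⟩, compl_compl A⟩
  · exact Or.inl ⟨hA, hv⟩

/-- Flipping a minimal element of an orientation keeps it consistent, and here it brings `s` one
step closer to `t`. -/
theorem exists_flip (hE : IsSideSystem E) {s t : Set (Set V)} (hs : IsNode E s)
    (ht : IsNode E t) {A : Set V} (hA : A ∈ s) (hAt : A ∉ t)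
    (hmin : ∀ D, D ∈ s → D ∉ t → D ⊆ A → D = A) :
    ∃ s', IsNode E s' ∧ IsFlip A s s' ∧ {D | D ∈ s' ∧ D ∉ t} ⊆ {D | D ∈ s ∧ D ∉ t} \ {A} := by
  have hAE := hs.subset hA
  have hAcE := hE.compl_mem A hAE
  -- Minimality in `s \ t` is minimality in all of `s`, because a subset of `A` lying in `t` would
  -- put `A` into `t`.
  have hmin' : ∀ D, D ∈ s → D ⊆ A → D = A := fun D hD h =>
    hmin D hD (fun hDt => hAt (ht.up D hDt A hAE h)) h
  have hAc : Aᶜ ≠ A := fun h => by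
    obtain ⟨a, ha⟩ := hE.nonempty A hAE
    have ha' := ha
    rw [← h] at ha'
    exact ha' ha
  refine ⟨{D | (D ∈ s ∧ D ≠ A) ∨ D = Aᶜ}, ⟨?_, ?_, ?_, ?_⟩, ⟨hA, Or.inr rfl, ?_⟩, ?_⟩
  · rintro D (h | rfl)
    exacts [hs.subset h.1, hAcE]
  · intro D hD
    have h1 := hs.mem_iff D hD
    have h2 : Dᶜ = A ↔ D = Aᶜ := by rw [compl_eq_comm, eq_comm]
    have h3 : Dᶜ = Aᶜ ↔ D = A := compl_inj_iff
    simp only [Set.mem_ofPred_eq, ne_eq, h2, h3]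
    by_cases h4 : D = A
    · subst h4
      simp [hAc.symm]
    · by_cases h5 : D = Aᶜ <;> simp [h4, h5] <;> tauto
  · rintro B (⟨hB, hBA⟩ | rfl) D hD hBD
    · refine Or.inl ⟨hs.up B hB D hD hBD, ?_⟩
      rintro rfl
      exact hBA (hmin' B hB hBD)
    · by_cases hDs : D ∈ s
      · by_cases hDA : D = A
        · subst hDA
          obtain ⟨a, ha⟩ := hE.nonempty _ hAcE
          exact absurd (hBD ha) ha
        · exact Or.inl ⟨hDs, hDA⟩
      · right
        rw [← hmin' Dᶜ (hs.compl_mem hD hDs) (Set.compl_subset_comm.1 hBD), compl_compl]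
  · intro v
    refine ((hs.finite v).insert Aᶜ).subset ?_
    rintro D ⟨h | h, hv⟩
    · exact Or.inr ⟨h.1, hv⟩
    · exact Or.inl h
  · exact fun D hD hne => Or.inl ⟨hD, hne⟩
  · rintro D ⟨h | rfl, hDt⟩
    · exact ⟨⟨h.1, hDt⟩, h.2⟩
    · exact absurd (ht.compl_mem hAE hAt) hDt

/-- Induction on the finite number of sides in `s` but not in `t`. The predicate `P` records which
flips are available, so that the lemma serves both for the whole tree and for the tree minus an
edge. -/
theorem reachable_of_flips [Nonempty V] (hE : IsSideSystem E) (P : Set V → Prop)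
    (H : SimpleGraph {O // IsNode E O})
    (hH : ∀ (s t : {O // IsNode E O}) (A : Set V), P A → IsFlip A s.1 t.1 → H.Adj s t)
    (s t : {O // IsNode E O}) (hst : ∀ A, A ∈ s.1 → A ∉ t.1 → P A) : H.Reachable s t := by
  induction hn : {A | A ∈ s.1 ∧ A ∉ t.1}.ncard using Nat.strong_induction_on generalizing s with
  | _ n ih =>
    have hfin := finite_diff s.2 t.2
    by_cases hemp : {A | A ∈ s.1 ∧ A ∉ t.1} = ∅
    · have hsub : s.1 ⊆ t.1 := fun A hA => by
        by_contra h
        exact (Set.eq_empty_iff_forall_notMem.1 hemp A) ⟨hA, h⟩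
      have : s = t := by
        refine Subtype.ext (hsub.antisymm fun A hA => ?_)
        by_contra h
        exact t.2.compl_notMem hA (hsub (s.2.compl_mem (t.2.subset hA) h))
      rw [this]
    · obtain ⟨A, hA⟩ := hfin.exists_minimal (Set.nonempty_iff_ne_empty.2 hemp)
      obtain ⟨s', hs', hflip, hsub⟩ := exists_flip hE s.2 t.2 hA.prop.1 hA.prop.2
        (fun D hD hDt hDA => hDA.antisymm (hA.le_of_le ⟨hD, hDt⟩ hDA))
      have hadj : H.Adj s ⟨s', hs'⟩ := hH s ⟨s', hs'⟩ A (hst A hA.prop.1 hA.prop.2) hflip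
      refine hadj.reachable.trans (ih _ ?_ ⟨s', hs'⟩ (fun D hD hDt => ?_) rfl)
      · rw [← hn]
        refine Set.ncard_lt_ncard ?_ hfin
        exact hsub.trans_ssubset (Set.sdiff_singleton_ssubset.2 hA.prop)
      · have := hsub ⟨hD, hDt⟩
        exact hst D this.1.1 this.1.2

/-- By `IsFlip.eq` only the edge `st` flips `A` or `Aᶜ`, so without it the orientation of `A` is
constant along walks. -/
theorem mem_iff_mem_of_reachable (hE : IsSideSystem E) {s t r r' : {O // IsNode E O}} {A : Set V}
    (h : IsFlip A s.1 t.1) (hr : ((flipTree E).deleteEdges {s(s, t)}).Reachable r r') :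
    A ∈ r.1 ↔ A ∈ r'.1 := by
  obtain ⟨p⟩ := hr
  induction p with
  | nil => rfl
  | @cons x y z hadj _ ih =>
    rw [← ih]
    rw [SimpleGraph.deleteEdges_adj] at hadj
    obtain ⟨⟨D, hD⟩, hne⟩ := hadj
    have hs := h.eq hE s.2 t.2
    have ht := (h.symm s.2 t.2).eq hE t.2 s.2
    have hx := hD.eq hE x.2 y.2
    have hy := (hD.symm x.2 y.2).eq hE y.2 x.2
    by_cases h₁ : A = D
    · subst h₁
      exact absurd (by rw [Subtype.ext (hx.trans hs.symm), Subtype.ext (hy.trans ht.symm)]; rfl) hne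
    · by_cases h₂ : A = Dᶜ
      · subst h₂
        rw [compl_compl] at ht
        refine absurd ?_ hne
        rw [Subtype.ext (hx.trans ht.symm), Subtype.ext (hy.trans hs.symm)]
        exact Sym2.eq_swap
      · exact hD.mem_iff x.2 y.2 h₁ h₂

theorem flipTree_isTree [Nonempty V] (hE : IsSideSystem E) : (flipTree E).IsTree where
  preconnected := fun s t => reachable_of_flips hE (fun _ => True) (flipTree E)
    (fun _ _ A _ h => ⟨A, h⟩) s t (fun _ _ _ => trivial)
  nonempty := ⟨⟨_, isNode_vertex hE (Classical.arbitrary V)⟩⟩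
  isAcyclic := by
    rw [SimpleGraph.isAcyclic_iff_forall_adj_isBridge]
    rintro s t ⟨A, hA⟩
    rw [SimpleGraph.isBridge_iff]
    intro hr
    exact t.2.notMem_of_compl hA.compl_mem ((mem_iff_mem_of_reachable hE hA hr).1 hA.mem)

theorem reachable_deleteEdges_iff [Nonempty V] (hE : IsSideSystem E) {s t : {O // IsNode E O}}
    {A : Set V} (h : IsFlip A s.1 t.1) (r : {O // IsNode E O}) :
    ((flipTree E).deleteEdges {s(s, t)}).Reachable s r ↔ A ∈ r.1 := by
  refine ⟨fun hr => (mem_iff_mem_of_reachable hE h hr).1 h.mem, fun hr => ?_⟩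
  refine reachable_of_flips hE (fun D => D ≠ A ∧ D ≠ Aᶜ) _ ?_ s r ?_
  · rintro x y D ⟨h₁, h₂⟩ hD
    rw [SimpleGraph.deleteEdges_adj]
    refine ⟨⟨D, hD⟩, fun hxy => ?_⟩
    rw [Set.mem_singleton_iff, Sym2.eq_iff] at hxy
    rcases hxy with ⟨rfl, rfl⟩ | ⟨rfl, rfl⟩
    · exact y.2.notMem_of_compl hD.compl_mem (h.other D hD.mem h₁)
    · exact y.2.notMem_of_compl hD.compl_mem ((h.symm y.2 x.2).other D hD.mem h₂)
  · refine fun D hD hDr => ⟨?_, ?_⟩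
    · rintro rfl
      exact hDr hr
    · rintro rfl
      exact s.2.compl_notMem h.mem hD

/-- The tree-cut decomposition of a graph into the classes of vertices that a system of sides does
not separate. -/
def decompositionOfSides [Nonempty V] (G : SimpleGraph V) (hE : IsSideSystem E) :
    TreeCutDecomposition G where
  Node := {O // IsNode E O}
  tree := flipTree E
  isTree := flipTree_isTree hE
  part t := {v | {A | A ∈ E ∧ v ∈ A} = t.1}
  disjoint := by
    intro s t hst
    rw [Set.disjoint_left]
    rintro v hs ht
    exact hst (Subtype.ext (Eq.trans (Eq.symm hs) ht))
  cover := by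
    refine Set.eq_univ_of_forall fun v => Set.mem_iUnion.2 ⟨⟨_, isNode_vertex hE v⟩, rfl⟩
  dense := by
    rintro s t ⟨A, hA⟩
    have hAE := s.2.subset hA.mem
    obtain ⟨v, hv⟩ := hE.nonempty A hAE
    obtain ⟨w, hw⟩ := hE.nonempty _ (hE.compl_mem A hAE)
    refine ⟨⟨_, isNode_vertex hE v⟩, ⟨_, isNode_vertex hE w⟩, ⟨v, rfl⟩, ⟨w, rfl⟩, ?_⟩
    obtain ⟨p, hp⟩ := ((flipTree_isTree hE).connected
      ⟨_, isNode_vertex hE v⟩ ⟨_, isNode_vertex hE w⟩).exists_isPath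
    refine ⟨p, hp, ?_⟩
    -- A path avoiding `st` could not lead from a node containing `A` to one that does not.
    by_contra hmem
    exact hw ((mem_iff_mem_of_reachable hE hA (p.toDeleteEdge _ hmem).reachable).1 ⟨hAE, hv⟩).2

theorem side_decompositionOfSides [Nonempty V] (G : SimpleGraph V) (hE : IsSideSystem E)
    {s t : {O // IsNode E O}} {A : Set V} (h : IsFlip A s.1 t.1) :
    (decompositionOfSides G hE).side s t = A := by
  have hA := s.2.subset h.mem
  ext v
  constructor
  · rintro ⟨r, hr, hv⟩
    have hr' := (reachable_deleteEdges_iff hE h r).1 hr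
    change {A | A ∈ E ∧ v ∈ A} = r.1 at hv
    rw [← hv] at hr'
    exact hr'.2
  · intro hv
    exact ⟨⟨_, isNode_vertex hE v⟩, (reachable_deleteEdges_iff hE h _).2 ⟨hA, hv⟩, rfl⟩

theorem fundamentalCuts_decompositionOfSides [Nonempty V] (G : SimpleGraph V)
    (hE : IsSideSystem E) : (decompositionOfSides G hE).fundamentalCuts = cut G '' E := by
  ext F
  constructor
  · rintro ⟨s, t, ⟨A, hA⟩, rfl⟩
    refine ⟨A, s.2.subset hA.mem, ?_⟩
    rw [side_decompositionOfSides G hE hA, side_decompositionOfSides G hE (hA.symm s.2 t.2)]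
    rfl
  · rintro ⟨A, hA, rfl⟩
    have hA' := hE.compl_mem A hA
    have hflip := isFlip_edge hA hA'
    refine ⟨⟨_, isNode_edge hE hA⟩, ⟨_, isNode_edge hE hA'⟩, ⟨A, hflip⟩, ?_⟩
    rw [side_decompositionOfSides G hE hflip,
      side_decompositionOfSides G hE (hflip.symm (isNode_edge hE hA) (isNode_edge hE hA'))]
    rfl

theorem exists_part_decompositionOfSides [Nonempty V] (G : SimpleGraph V) (hE : IsSideSystem E)
    {P : Set V} {v : V} (hv : v ∈ P) :
    (∃ t, (decompositionOfSides G hE).part t = P) ↔ P = {w | ∀ A ∈ E, v ∈ A ↔ w ∈ A} := by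
  have key : ∀ w, ({A | A ∈ E ∧ w ∈ A} = {A | A ∈ E ∧ v ∈ A}) ↔ ∀ A ∈ E, v ∈ A ↔ w ∈ A := by
    intro w
    simp only [Set.ext_iff, Set.mem_ofPred_eq]
    exact forall_congr' fun A => by tauto
  constructor
  · rintro ⟨t, rfl⟩
    change {A | A ∈ E ∧ v ∈ A} = t.1 at hv
    ext w
    rw [Set.mem_ofPred_eq, ← key, hv]
    rfl
  · rintro rfl
    exact ⟨⟨_, isNode_vertex hE v⟩, Set.ext key⟩

end Tree

/-! ### Side systems of nested sets of bonds -/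

section BondSystems

variable {V : Type u} {G : SimpleGraph V}

/-- The sides of the cuts in `B`. -/
def sides (G : SimpleGraph V) (B : Set (Set (Sym2 V))) : Set (Set V) :=
  {A | ∃ F ∈ B, IsCutWithSide G F A}

theorem IsCutWithSide.compl {F : Set (Sym2 V)} {A : Set V} (h : IsCutWithSide G F A) :
    IsCutWithSide G F Aᶜ :=
  ⟨h.2.1, by rw [compl_compl]; exact h.1, h.2.2.trans cut_compl.symm⟩

theorem IsCutWithSide.eq_or_eq_compl (hG : G.Connected) {F : Set (Sym2 V)} {A D : Set V}
    (hA : IsCutWithSide G F A) (hD : IsCutWithSide G F D) : D = A ∨ D = Aᶜ :=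
  cut_eq_cut hG (hA.2.2.symm.trans hD.2.2)

theorem IsBond.isBondSide (hG : G.Connected) {F : Set (Sym2 V)} (hF : IsBond G F) {A : Set V}
    (hA : IsCutWithSide G F A) : IsBondSide G A := by
  obtain ⟨D, hD, h₁, h₂⟩ := hF
  have hDs : IsBondSide G D := ⟨linked_of_connected_induce h₁, linked_of_connected_induce h₂⟩
  rcases hD.eq_or_eq_compl hG hA with rfl | rfl
  exacts [hDs, hDs.compl]

theorem nestedSides_of_nested (hG : G.Connected) {F F' : Set (Sym2 V)} (h : Nested G F F')
    {A D : Set V} (hA : IsCutWithSide G F A) (hD : IsCutWithSide G F' D) : NestedSides A D := by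
  obtain ⟨X, Y, hX, hY, hXY⟩ := h
  rcases hA.eq_or_eq_compl hG hX with rfl | rfl <;> rcases hD.eq_or_eq_compl hG hY with rfl | rfl
  · exact Or.inl hXY
  · exact Or.inr (Or.inl hXY)
  · exact Or.inr (Or.inr (Or.inl hXY))
  · exact Or.inr (Or.inr (Or.inr hXY))

theorem isSideSystem_sides (hG : G.Connected) {k : ℕ} {B : Set (Set (Sym2 V))}
    (hB : IsNestedSetOfBonds G B) (hk : ∀ F ∈ B, F.encard < k) : IsSideSystem (sides G B) where
  compl_mem := fun _ ⟨F, hF, h⟩ => ⟨F, hF, h.compl⟩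
  nonempty := fun _ ⟨_, _, h⟩ => h.1
  nested := fun _ ⟨F, hF, h⟩ _ ⟨F', hF', h'⟩ => nestedSides_of_nested hG (hB.2 F hF F' hF') h h'
  finite := fun v w => by
    refine (finite_bondSides_separating k G v w (hG v w)).subset ?_
    rintro A ⟨⟨F, hF, h⟩, hv, hw⟩
    refine ⟨hv, hw, (hB.1 F hF).isBondSide hG h, ?_⟩
    have := (hk F hF).le
    rwa [h.2.2] at this

theorem cut_image_sides {B : Set (Set (Sym2 V))} (hB : ∀ F ∈ B, IsBond G F) :
    cut G '' sides G B = B := by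
  ext F
  constructor
  · rintro ⟨A, ⟨F', hF', h⟩, rfl⟩
    rwa [cut, ← h.2.2]
  · intro hF
    obtain ⟨A, hA, -⟩ := hB F hF
    exact ⟨A, ⟨F, hF, hA⟩, hA.2.2.symm⟩

theorem exists_treeCutDecomposition (hG : G.Connected) {k : ℕ} {B : Set (Set (Sym2 V))}
    (hB : IsNestedSetOfBonds G B) (hk : ∀ F ∈ B, F.encard < k) :
    ∃ D : TreeCutDecomposition G, D.fundamentalCuts = B ∧ ∀ P : Set V, ∀ v ∈ P,
      ((∃ t, D.part t = P) ↔ P = {w | ∀ A ∈ sides G B, v ∈ A ↔ w ∈ A}) := by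
  have := hG.nonempty
  have hE := isSideSystem_sides hG hB hk
  exact ⟨decompositionOfSides G hE,
    (fundamentalCuts_decompositionOfSides G hE).trans (cut_image_sides hB.1),
    fun P v hv => exists_part_decompositionOfSides G hE hv⟩

end BondSystems

end EdgeBlocks
namespace EdgeBlocks

/-! ### Vertices and rays relative to finite cuts -/

section Inside

variable {V : Type u} {G : SimpleGraph V} {A B D Q Q' : Set V} {p q x y : V ⊕ Ray G}

theorem Ray.eventually_edge_notMem (R : Ray G) {F : Set (Sym2 V)} (hF : F.Finite) :
    ∀ᶠ n in Filter.atTop, s(R.vertex n, R.vertex (n + 1)) ∉ F := by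
  have hinj : Function.Injective fun n => s(R.vertex n, R.vertex (n + 1)) := by
    intro n m h
    rcases Sym2.eq_iff.1 h with ⟨h, -⟩ | ⟨h, h'⟩
    · exact R.injective h
    · have := R.injective h
      have := R.injective h'
      omega
  rw [← Nat.cofinite_eq_atTop]
  exact hinj.tendsto_cofinite.eventually hF.compl_mem_cofinite

/-- The vertex lies in `A`, or the ray has a tail in `A`. -/
def Inside (p : V ⊕ Ray G) (A : Set V) : Prop :=
  match p with
  | Sum.inl v => v ∈ A
  | Sum.inr R => ∀ᶠ n in Filter.atTop, R.vertex n ∈ A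

theorem inside_inter : Inside p (A ∩ B) ↔ Inside p A ∧ Inside p B := by
  cases p
  · rfl
  · exact Filter.eventually_and

theorem not_inside_empty : ¬ Inside p ∅ := by
  cases p <;> simp only [Inside, Set.mem_empty_iff_false, Filter.eventually_const,
    not_false_eq_true]

theorem Inside.mono (h : Inside p A) (hAB : A ⊆ B) : Inside p B := by
  cases p
  · exact hAB h
  · exact Filter.Eventually.mono h fun _ h => hAB h

/-- A ray uses only finitely many edges of a finite cut, so it eventually stays on one side. -/
theorem inside_compl (hA : (cut G A).Finite) : Inside p Aᶜ ↔ ¬ Inside p A := by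
  cases p with
  | inl v => rfl
  | inr R =>
    constructor
    · intro h h'
      obtain ⟨n, h₁, h₂⟩ := (Filter.Eventually.and h h').exists
      exact h₁ h₂
    · intro h
      obtain ⟨m, hm⟩ := Filter.eventually_atTop.1 (R.eventually_edge_notMem hA)
      have hstep : ∀ n, m ≤ n → (R.vertex n ∈ A ↔ R.vertex m ∈ A) := by
        intro n hn
        induction n, hn using Nat.le_induction with
        | base => rfl
        | succ n hn ih =>
          rw [← ih]
          have := hm n hn
          rw [mem_cut] at this
          have := R.adj n
          tauto
      refine Filter.eventually_atTop.2 ⟨m, fun n hn hnA => h ?_⟩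
      exact Filter.eventually_atTop.2 ⟨m, fun n' hn' => (hstep n' hn').2 ((hstep n hn).1 hnA)⟩

theorem finite_cut_compl (hA : (cut G A).Finite) : (cut G Aᶜ).Finite := by rwa [cut_compl]

theorem finite_cut_inter (hA : (cut G A).Finite) (hB : (cut G B).Finite) :
    (cut G (A ∩ B)).Finite := by
  refine (hA.union hB).subset fun e => ?_
  induction e with
  | _ a b =>
    simp only [Set.mem_union, mem_cut, Set.mem_inter_iff]
    tauto

theorem finite_cut_union (hA : (cut G A).Finite) (hB : (cut G B).Finite) :
    (cut G (A ∪ B)).Finite := by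
  rw [← cut_compl, Set.compl_union]
  exact finite_cut_inter (finite_cut_compl hA) (finite_cut_compl hB)

theorem inside_union (hA : (cut G A).Finite) (hB : (cut G B).Finite) :
    Inside p (A ∪ B) ↔ Inside p A ∨ Inside p B := by
  have h := inside_compl (p := p) (finite_cut_union hA hB)
  rw [Set.compl_union, inside_inter, inside_compl hA, inside_compl hB] at h
  tauto

/-- Exactly one of `p` and `q` is inside `A`. -/
def Sep (p q : V ⊕ Ray G) (A : Set V) : Prop := ¬ (Inside p A ↔ Inside q A)

theorem sep_compl (hA : (cut G A).Finite) : Sep p q Aᶜ ↔ Sep p q A := by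
  unfold Sep
  rw [inside_compl hA, inside_compl hA]
  tauto

/-- `A` separates `p` from `q` by a finite cut of minimum size. -/
structure Eff (p q : V ⊕ Ray G) (A : Set V) : Prop where
  finite : (cut G A).Finite
  sep : Sep p q A
  le : ∀ B, (cut G B).Finite → Sep p q B → (cut G A).encard ≤ (cut G B).encard

theorem Eff.of_sep (hA : Eff p q A) (hQ : Sep p q Q)
    (h : (cut G Q).encard ≤ (cut G A).encard) :
    Eff p q Q ∧ (cut G Q).encard = (cut G A).encard := by
  have hfin : (cut G Q).Finite := by
    rw [← Set.encard_lt_top_iff] at *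
    exact h.trans_lt (Set.encard_lt_top_iff.2 hA.finite)
  exact ⟨⟨hfin, hQ, fun B hB hs => h.trans (hA.le B hB hs)⟩, h.antisymm (hA.le Q hfin hQ)⟩

theorem Eff.compl (hA : Eff p q A) : Eff p q Aᶜ :=
  (hA.of_sep ((sep_compl hA.finite).2 hA.sep) (by rw [cut_compl])).1

/-- As `Q'` still separates `x` from `y`, its order is at least that of `D`; the inequality `hsum`
then leaves `Q` at most the order of `A`. -/
theorem Eff.of_corner (hA : Eff p q A) (hD : Eff x y D)
    (hsum : (cut G Q).encard + (cut G Q').encard ≤ (cut G A).encard + (cut G D).encard)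
    (hQ : Sep p q Q) (hQ' : Sep x y Q') (hfin : (cut G Q').Finite) :
    Eff p q Q ∧ (cut G Q).encard = (cut G A).encard := by
  refine hA.of_sep hQ ?_
  have h1 := (add_le_add_right (hD.le Q' hfin hQ') (cut G Q).encard).trans hsum
  exact (ENat.add_le_add_iff_right (Set.encard_ne_top_iff.2 hD.finite)).1 h1

/-- If `A` split into two pieces without edges between them, its cut would be the disjoint union of
their non-empty cuts. Both would be strictly smaller, so neither piece would separate `p` from `q`,
and then neither would their union `A`. -/
theorem Eff.linked (hG : G.Connected) (hA : Eff p q A) : Linked G A := by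
  intro B h₁ h₂
  by_contra! hno
  have hadj : ∀ a b, a ∈ A → b ∈ A → G.Adj a b → (a ∈ B ↔ b ∈ B) := by
    intro a b ha hb hab
    by_contra hne
    by_cases haB : a ∈ B
    · exact hno a ⟨ha, haB⟩ b ⟨hb, by tauto⟩ hab
    · exact hno b ⟨hb, by tauto⟩ a ⟨ha, haB⟩ hab.symm
  have hsub₁ : cut G (A ∩ B) ⊆ cut G A := by
    intro e
    induction e with
    | _ a b =>
      simp only [mem_cut, Set.mem_inter_iff]
      have := hadj a b
      tauto
  have hsub₂ : cut G (A \ B) ⊆ cut G A := by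
    intro e
    induction e with
    | _ a b =>
      simp only [mem_cut, Set.mem_sdiff]
      have := hadj a b
      tauto
  have hdisj : Disjoint (cut G (A ∩ B)) (cut G (A \ B)) := by
    rw [Set.disjoint_left]
    intro e
    induction e with
    | _ a b =>
      simp only [mem_cut, Set.mem_sdiff, Set.mem_inter_iff]
      have := hadj a b
      tauto
  have hne : ∀ C : Set V, C ⊆ A → C.Nonempty → (cut G C).Nonempty := by
    intro C hC hCne
    refine cut_nonempty hG hCne ?_
    rw [Set.nonempty_compl]
    rintro rfl
    have hAu : A = Set.univ := Set.univ_subset_iff.1 hC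
    refine hA.sep ?_
    subst hAu
    cases p <;> cases q <;> simp [Inside]
  have hfin₁ := hA.finite.subset hsub₁
  have hfin₂ := hA.finite.subset hsub₂
  have hlt : ∀ C C' : Set V, cut G C ⊆ cut G A → cut G C' ⊆ cut G A →
      Disjoint (cut G C) (cut G C') → (cut G C').Nonempty → ¬ Sep p q C := by
    intro C C' hC hC' hd ⟨e, he⟩ hs
    have h := hA.le C (hA.finite.subset hC) hs
    have : cut G C = cut G A := hA.finite.eq_of_subset_of_encard_le' hC h
    exact Set.disjoint_left.1 hd (this ▸ hC' he) he
  have h₃ := hlt _ _ hsub₁ hsub₂ hdisj (hne _ Set.sdiff_subset h₂)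
  have h₄ := hlt _ _ hsub₂ hsub₁ hdisj.symm (hne _ Set.inter_subset_left h₁)
  have hs := hA.sep
  unfold Sep at h₃ h₄ hs
  rw [← Set.inter_union_sdiff A B, inside_union hfin₁ hfin₂, inside_union hfin₁ hfin₂] at hs
  tauto

theorem Eff.isBondSide (hG : G.Connected) (hA : Eff p q A) : IsBondSide G A :=
  ⟨hA.linked hG, hA.compl.linked hG⟩

theorem Eff.nonempty (hA : Eff p q A) : A.Nonempty := by
  rw [Set.nonempty_iff_ne_empty]
  rintro rfl
  exact hA.sep (iff_of_false not_inside_empty not_inside_empty)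

end Inside

/-! ### A canonical nested set of bonds -/

section Selection

variable {V : Type u} {G : SimpleGraph V} {A B D : Set V} {p q x y : V ⊕ Ray G} {k : ℕ}
  {prev : Set (Set V)}

/-- `A` separates `p` and `q` efficiently by a cut of order `k` that is nested with `prev`. -/
structure Candidate (k : ℕ) (prev : Set (Set V)) (p q : V ⊕ Ray G) (A : Set V) : Prop where
  eff : Eff p q A
  order : (cut G A).encard = k
  nested : ∀ D ∈ prev, NestedSides A D

/-- The candidates of order `k`, for arbitrary pairs, that cross `A`. -/
def crossing (G : SimpleGraph V) (k : ℕ) (prev : Set (Set V)) (A : Set V) : Set (Set V) :=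
  {D | (∃ p q : V ⊕ Ray G, Candidate k prev p q D) ∧ ¬ NestedSides A D}

/-- The candidates of order `k` that are crossed by as few candidates as possible. -/
def select (G : SimpleGraph V) (k : ℕ) (prev : Set (Set V)) : Set (Set V) :=
  {A | ∃ p q : V ⊕ Ray G, Candidate k prev p q A ∧ ∀ B, Candidate k prev p q B →
    (crossing G k prev A).ncard ≤ (crossing G k prev B).ncard}

/-- The sides of order less than `k` of the canonical nested set of bonds. -/
def selectBelow (G : SimpleGraph V) : ℕ → Set (Set V)
  | 0 => ∅
  | k + 1 => selectBelow G k ∪ select G k (selectBelow G k)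

/-- The canonical nested set of bonds. -/
def canonicalBonds (G : SimpleGraph V) : Set (Set (Sym2 V)) :=
  {F | ∃ k, ∃ A ∈ selectBelow G k, cut G A = F}

/-! ### Uncrossing from cuts of smaller order -/

/-- Being too small, `D` has `p` and `q` on one side, and exactly one of `x`, `y` lies on the other.
The corner containing that one separates `x` from `y`, and the opposite corner separates `p` from
`q`; the latter replaces `A`. -/
theorem Eff.exists_corner (hA : Eff p q A) (hD : Eff x y D)
    (hlt : (cut G D).encard < (cut G A).encard) (hcross : ¬ NestedSides A D) :
    ∃ Q, Eff p q Q ∧ (cut G Q).encard = (cut G A).encard ∧ NestedSides Q D ∧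
      ∀ C, NestedSides A C → NestedSides D C → NestedSides Q C := by
  have hn : ¬ Sep p q D := fun h => (hA.le D hD.finite h).not_gt hlt
  have main : ∀ D', Eff x y D' → ¬ NestedSides A D' → (cut G D').encard = (cut G D).encard →
      (Sep p q (A ∩ D') ∧ Sep x y (A ∪ D') ∨ Sep p q (A ∪ D') ∧ Sep x y (A ∩ D')) →
      ∃ Q, Eff p q Q ∧ (cut G Q).encard = (cut G A).encard ∧ NestedSides Q D' ∧
      ∀ C, NestedSides A C → NestedSides D' C → NestedSides Q C := by
    rintro D' hD' hc ho (⟨h₁, h₂⟩ | ⟨h₁, h₂⟩)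
    · obtain ⟨h₃, h₄⟩ := hA.of_corner hD' cut_inter_union_submodular h₁ h₂
        (finite_cut_union hA.finite hD'.finite)
      exact ⟨_, h₃, h₄, Or.inl Set.inter_subset_right, fun C h h' => NestedSides.inter hc h h'⟩
    · obtain ⟨h₃, h₄⟩ := hA.of_corner hD'
        ((add_comm _ _).trans_le cut_inter_union_submodular) h₁ h₂
        (finite_cut_inter hA.finite hD'.finite)
      exact ⟨_, h₃, h₄, NestedSides.symm (Or.inl Set.subset_union_right),
        fun C h h' => NestedSides.union hc h h'⟩
  have hsA := hA.sep
  have hsD := hD.sep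
  have hfc := finite_cut_compl hD.finite
  -- The two pairs of opposite corners are those of `A` with `D` and of `A` with `Dᶜ`; if the first
  -- pair fails, the second works.
  by_cases hc : Sep p q (A ∩ D) ∧ Sep x y (A ∪ D) ∨ Sep p q (A ∪ D) ∧ Sep x y (A ∩ D)
  · exact main D hD hcross rfl hc
  · obtain ⟨Q, h₁, h₂, h₃, h₄⟩ := main Dᶜ hD.compl (by rwa [nestedSides_compl_right])
      (by rw [cut_compl]) (by
        unfold Sep at *
        simp only [inside_inter, inside_union hA.finite hD.finite,
          inside_union hA.finite hfc, inside_compl hD.finite] at *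
        grind)
    exact ⟨Q, h₁, h₂, nestedSides_compl_right.1 h₃,
      fun C h h' => h₄ C h (nestedSides_compl_left.2 h')⟩

/-- Each replacement by a corner removes a crossing with `prev` and creates none. The number of
crossings is finite because the members of `prev` are bond sides of bounded order. -/
theorem exists_candidate (hG : G.Connected) (hnest : ∀ C ∈ prev, ∀ D ∈ prev, NestedSides C D)
    (hprev : ∀ D ∈ prev, (∃ x y : V ⊕ Ray G, Eff x y D) ∧ (cut G D).encard < k)
    (hA : Eff p q A) (hk : (cut G A).encard = k) : ∃ B, Candidate k prev p q B := by
  induction hn : {D | D ∈ prev ∧ ¬ NestedSides A D}.ncard using Nat.strong_induction_on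
    generalizing A with
  | _ n ih =>
    by_cases hall : ∀ D ∈ prev, NestedSides A D
    · exact ⟨A, hA, hk, hall⟩
    · push Not at hall
      obtain ⟨D, hD, hcross⟩ := hall
      obtain ⟨⟨x, y, hxy⟩, hlt⟩ := hprev D hD
      obtain ⟨Q, h₁, h₂, h₃, h₄⟩ := hA.exists_corner hxy (hk ▸ hlt) hcross
      refine ih _ ?_ h₁ (h₂.trans hk) rfl
      rw [← hn]
      refine Set.ncard_lt_ncard ((Set.ssubset_iff_of_subset ?_).2 ⟨D, ⟨hD, hcross⟩, ?_⟩) ?_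
      · rintro C ⟨hC, hQC⟩
        exact ⟨hC, fun h => hQC (h₄ C h (hnest D hD C hC))⟩
      · exact fun h => h.2 h₃
      · refine (finite_crossing_bondSides hG hA.finite k).subset ?_
        rintro C ⟨hC, hAC⟩
        obtain ⟨⟨x', y', hxy'⟩, hlt'⟩ := hprev C hC
        exact ⟨hxy'.isBondSide hG, hlt'.le, hAC⟩

/-! ### Uncrossing candidates of equal order -/

theorem finite_crossing (hG : G.Connected) (hA : (cut G A).Finite) :
    (crossing G k prev A).Finite := by
  refine (finite_crossing_bondSides hG hA k).subset ?_
  rintro D ⟨⟨p, q, h⟩, hAD⟩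
  exact ⟨h.eff.isBondSide hG, h.order.le, hAD⟩

theorem crossing_compl : crossing G k prev Aᶜ = crossing G k prev A := by
  unfold crossing
  simp only [nestedSides_compl_left]

/-- A set crossing one corner crosses `A` or `B`, and a set crossing both corners crosses both. The
inequality is strict because `B` is itself a candidate that crosses `A` but neither corner. -/
theorem ncard_crossing_inter_add_union_lt (hG : G.Connected) (hA : Candidate k prev p q A)
    (hB : Candidate k prev x y B) (hAB : ¬ NestedSides A B) :
    (crossing G k prev (A ∩ B)).ncard + (crossing G k prev (A ∪ B)).ncard <
      (crossing G k prev A).ncard + (crossing G k prev B).ncard := by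
  have hfA := finite_crossing (k := k) (prev := prev) hG hA.eff.finite
  have hfB := finite_crossing (k := k) (prev := prev) hG hB.eff.finite
  have hfI := finite_crossing (k := k) (prev := prev) hG
    (finite_cut_inter hA.eff.finite hB.eff.finite)
  have hfU := finite_crossing (k := k) (prev := prev) hG
    (finite_cut_union hA.eff.finite hB.eff.finite)
  rw [← Set.ncard_union_add_ncard_inter _ _ hfI hfU,
    ← Set.ncard_union_add_ncard_inter _ _ hfA hfB]
  refine add_lt_add_of_lt_of_le (Set.ncard_lt_ncard ?_ (hfA.union hfB))
    (Set.ncard_le_ncard ?_ (hfA.inter_of_left _))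
  · refine (Set.ssubset_iff_of_subset ?_).2 ⟨B, Or.inl ⟨⟨x, y, hB⟩, hAB⟩, ?_⟩
    · rintro D (⟨hD, h⟩ | ⟨hD, h⟩)
      · by_cases hAD : NestedSides A D
        · exact Or.inr ⟨hD, fun hBD => h (NestedSides.inter hAB hAD hBD)⟩
        · exact Or.inl ⟨hD, hAD⟩
      · by_cases hAD : NestedSides A D
        · exact Or.inr ⟨hD, fun hBD => h (NestedSides.union hAB hAD hBD)⟩
        · exact Or.inl ⟨hD, hAD⟩
    · rintro (⟨-, h⟩ | ⟨-, h⟩)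
      · exact h (Or.inl Set.inter_subset_right)
      · exact h (NestedSides.symm (Or.inl Set.subset_union_right))
  · rintro D ⟨⟨hD, h₁⟩, -, h₂⟩
    refine ⟨⟨hD, fun h => ?_⟩, hD, fun h => ?_⟩
    · rcases h.inter_or_union (B := B) with h | h
      exacts [h₁ h, h₂ h]
    · rcases h.inter_or_union (B := A) with h | h
      · rw [Set.inter_comm] at h
        exact h₁ h
      · rw [Set.union_comm] at h
        exact h₂ h

/-- `A` is a candidate for `p` and `q` with as few crossings as possible. -/
def MinCandidate (k : ℕ) (prev : Set (Set V)) (p q : V ⊕ Ray G) (A : Set V) : Prop :=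
  Candidate k prev p q A ∧ ∀ B, Candidate k prev p q B →
    (crossing G k prev A).ncard ≤ (crossing G k prev B).ncard

theorem MinCandidate.compl (h : MinCandidate k prev p q A) : MinCandidate k prev p q Aᶜ := by
  refine ⟨⟨h.1.eff.compl, by rw [cut_compl, h.1.order], fun D hD => ?_⟩, ?_⟩
  · exact nestedSides_compl_left.2 (h.1.nested D hD)
  · rw [crossing_compl]
    exact h.2

theorem Candidate.of_sep (hA : Candidate k prev p q A) (hB : Candidate k prev x y B)
    (hAB : ¬ NestedSides A B) {Q : Set V} (hQ : Q = A ∩ B ∨ Q = A ∪ B) (hs : Sep p q Q)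
    (hk : (cut G Q).encard = k) : Candidate k prev p q Q := by
  refine ⟨(hA.eff.of_sep hs (by rw [hk, hA.order])).1, hk, fun D hD => ?_⟩
  rcases hQ with rfl | rfl
  · exact (hA.nested D hD).inter hAB (hB.nested D hD)
  · exact (hA.nested D hD).union hAB (hB.nested D hD)

theorem order_corners (hA : (cut G A).encard = k) (hB : (cut G B).encard = k)
    (hI : k ≤ (cut G (A ∩ B)).encard) (hU : k ≤ (cut G (A ∪ B)).encard) :
    (cut G (A ∩ B)).encard = k ∧ (cut G (A ∪ B)).encard = k := by
  have h := cut_inter_union_submodular (G := G) (A := A) (B := B)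
  rw [hA, hB] at h
  constructor
  · refine le_antisymm ?_ hI
    exact (ENat.add_le_add_iff_right (ENat.natCast_ne_top k)).1 ((add_le_add_right hU _).trans h)
  · refine le_antisymm ?_ hU
    exact (ENat.add_le_add_iff_left (ENat.natCast_ne_top k)).1 ((add_le_add_left hI _).trans h)

/-- In each case both corners have order at least `k`, hence exactly `k` by `order_corners`, and so
are candidates. Minimality bounds their crossing numbers below by those of `A` or `B`, against
strict submodularity. If both corners serve the same pair, this yields only a strict inequality
between the crossing numbers of `A` and `B`. -/
theorem MinCandidate.not_sep (hG : G.Connected) (hA : MinCandidate k prev p q A)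
    (hB : MinCandidate k prev x y B) (hAB : ¬ NestedSides A B) :
    ¬ (Sep p q (A ∩ B) ∧ Sep x y (A ∪ B)) ∧ ¬ (Sep x y (A ∩ B) ∧ Sep p q (A ∪ B)) ∧
    (Sep p q (A ∩ B) → Sep p q (A ∪ B) →
      (crossing G k prev A).ncard < (crossing G k prev B).ncard) ∧
    (Sep x y (A ∩ B) → Sep x y (A ∪ B) →
      (crossing G k prev B).ncard < (crossing G k prev A).ncard) := by
  have hlt := ncard_crossing_inter_add_union_lt hG hA.1 hB.1 hAB
  have hfI := finite_cut_inter hA.1.eff.finite hB.1.eff.finite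
  have hfU := finite_cut_union hA.1.eff.finite hB.1.eff.finite
  have leA : ∀ Q, (cut G Q).Finite → Sep p q Q → k ≤ (cut G Q).encard := fun Q hf hs =>
    hA.1.order.symm.le.trans (hA.1.eff.le Q hf hs)
  have leB : ∀ Q, (cut G Q).Finite → Sep x y Q → k ≤ (cut G Q).encard := fun Q hf hs =>
    hB.1.order.symm.le.trans (hB.1.eff.le Q hf hs)
  have hBA : ¬ NestedSides B A := fun h => hAB h.symm
  have minA : ∀ Q, Q = A ∩ B ∨ Q = A ∪ B → Sep p q Q → (cut G Q).encard = k →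
      (crossing G k prev A).ncard ≤ (crossing G k prev Q).ncard := fun Q hQ hs hk =>
    hA.2 Q (hA.1.of_sep hB.1 hAB hQ hs hk)
  have minB : ∀ Q, Q = A ∩ B ∨ Q = A ∪ B → Sep x y Q → (cut G Q).encard = k →
      (crossing G k prev B).ncard ≤ (crossing G k prev Q).ncard := fun Q hQ hs hk =>
    hB.2 Q (hB.1.of_sep hA.1 hBA (by rwa [Set.inter_comm, Set.union_comm]) hs hk)
  have ord := order_corners hA.1.order hB.1.order
  refine ⟨fun ⟨h₁, h₂⟩ => ?_, fun ⟨h₁, h₂⟩ => ?_, fun h₁ h₂ => ?_, fun h₁ h₂ => ?_⟩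
  · obtain ⟨o₁, o₂⟩ := ord (leA _ hfI h₁) (leB _ hfU h₂)
    have := minA _ (Or.inl rfl) h₁ o₁
    have := minB _ (Or.inr rfl) h₂ o₂
    omega
  · obtain ⟨o₁, o₂⟩ := ord (leB _ hfI h₁) (leA _ hfU h₂)
    have := minB _ (Or.inl rfl) h₁ o₁
    have := minA _ (Or.inr rfl) h₂ o₂
    omega
  · obtain ⟨o₁, o₂⟩ := ord (leA _ hfI h₁) (leA _ hfU h₂)
    have := minA _ (Or.inl rfl) h₁ o₁
    have := minA _ (Or.inr rfl) h₂ o₂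
    omega
  · obtain ⟨o₁, o₂⟩ := ord (leB _ hfI h₁) (leB _ hfU h₂)
    have := minB _ (Or.inl rfl) h₁ o₁
    have := minB _ (Or.inr rfl) h₂ o₂
    omega

/-- If `A` and `B` crossed, `MinCandidate.not_sep` would apply to both pairs of opposite corners. If
`p`, `q` lie on one side of `B`, or `x`, `y` on one side of `A`, some opposite corners separate one
pair each. Otherwise both pairs occupy opposite corners: the same ones, which is excluded, or
different ones, which gives two contradictory strict inequalities. -/
theorem MinCandidate.nestedSides (hG : G.Connected) (hA : MinCandidate k prev p q A)
    (hB : MinCandidate k prev x y B) : NestedSides A B := by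
  by_contra hAB
  obtain ⟨h₁, h₂, h₃, h₄⟩ := hA.not_sep hG hB hAB
  obtain ⟨h₅, h₆, h₇, h₈⟩ := hA.not_sep hG hB.compl (by rwa [nestedSides_compl_right])
  have hfA := hA.1.eff.finite
  have hfB := hB.1.eff.finite
  have hfc := finite_cut_compl hfB
  have h₉ := hA.1.eff.sep
  have h₁₀ := hB.1.eff.sep
  rw [crossing_compl] at h₇ h₈
  have h₁₁ : ∀ m n : ℕ, m < n → ¬ n < m := fun m n h h' => (h.trans h').false
  have h₁₂ := h₁₁ (crossing G k prev A).ncard (crossing G k prev B).ncard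
  unfold Sep at *
  simp only [inside_inter, inside_union hfA hfB, inside_union hfA hfc, inside_compl hfB] at *
  -- What remains is propositional: the positions of the four points and two mutually exclusive
  -- inequalities.
  generalize ((crossing G k prev A).ncard < (crossing G k prev B).ncard) = c₁ at *
  generalize ((crossing G k prev B).ncard < (crossing G k prev A).ncard) = c₂ at *
  clear h₁₁ hfA hfB hfc hA hB hAB
  grind

theorem exists_mem_select (h : ∃ A, Candidate k prev p q A) :
    ∃ A ∈ select G k prev, Eff p q A := by
  obtain ⟨A, hA⟩ := h
  induction hn : (crossing G k prev A).ncard using Nat.strong_induction_on generalizing A with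
  | _ n ih =>
    by_cases hmin : ∀ B, Candidate k prev p q B →
        (crossing G k prev A).ncard ≤ (crossing G k prev B).ncard
    · exact ⟨A, ⟨p, q, hA, hmin⟩, hA.eff⟩
    · push Not at hmin
      obtain ⟨B, hB, hlt⟩ := hmin
      exact ih _ (hn ▸ hlt) B hB rfl

/-- Sides of different orders are nested because candidates are required to respect the earlier
selection; sides of equal order are nested by `MinCandidate.nestedSides`. -/
theorem selectBelow_spec (hG : G.Connected) (k : ℕ) :
    (∀ C ∈ selectBelow G k, ∀ D ∈ selectBelow G k, NestedSides C D) ∧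
    ∀ D ∈ selectBelow G k, (∃ x y : V ⊕ Ray G, Eff x y D) ∧ (cut G D).encard < k := by
  induction k with
  | zero => exact ⟨fun _ h => h.elim, fun _ h => h.elim⟩
  | succ k ih =>
    refine ⟨?_, ?_⟩
    · rintro C (hC | ⟨p, q, hC⟩) D (hD | ⟨x, y, hD⟩)
      · exact ih.1 C hC D hD
      · exact (hD.1.nested C hC).symm
      · exact hC.1.nested D hD
      · exact MinCandidate.nestedSides hG hC hD
    · have hlt : (k : ℕ∞) < (k + 1 : ℕ) := by exact_mod_cast Nat.lt_succ_self k
      rintro D (hD | ⟨x, y, hD, -⟩)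
      · exact ⟨(ih.2 D hD).1, (ih.2 D hD).2.trans hlt⟩
      · exact ⟨⟨x, y, hD.eff⟩, hD.order ▸ hlt⟩

theorem selectBelow_mono (G : SimpleGraph V) : Monotone (selectBelow G) :=
  monotone_nat_of_le_succ fun _ => Set.subset_union_left

theorem exists_mem_selectBelow (hG : G.Connected) (hA : Eff p q A) :
    ∃ k, ∃ B ∈ selectBelow G k, Eff p q B := by
  obtain ⟨k, hk⟩ := ENat.ne_top_iff_exists.1 (Set.encard_ne_top_iff.2 hA.finite)
  obtain ⟨B, hB, h⟩ := exists_mem_select (exists_candidate hG (selectBelow_spec hG k).1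
    (selectBelow_spec hG k).2 hA hk.symm)
  exact ⟨k + 1, B, Or.inr hB, h⟩

theorem isNestedSetOfBonds_canonicalBonds (hG : G.Connected) :
    IsNestedSetOfBonds G (canonicalBonds G) := by
  have hcut : ∀ k, ∀ A ∈ selectBelow G k, IsCutWithSide G (cut G A) A := by
    intro k A hA
    obtain ⟨⟨x, y, h⟩, -⟩ := (selectBelow_spec hG k).2 A hA
    exact ⟨h.nonempty, h.compl.nonempty, rfl⟩
  refine ⟨?_, ?_⟩
  · rintro F ⟨k, A, hA, rfl⟩
    obtain ⟨⟨x, y, h⟩, -⟩ := (selectBelow_spec hG k).2 A hA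
    have hb := h.isBondSide hG
    exact ⟨A, hcut k A hA, hb.linked.connected_induce h.nonempty,
      hb.linked_compl.connected_induce h.compl.nonempty⟩
  · rintro F ⟨k, A, hA, rfl⟩ F' ⟨l, D, hD, rfl⟩
    have hA' := hcut k A hA
    have hD' := hcut l D hD
    rcases (selectBelow_spec hG (max k l)).1 A (selectBelow_mono G (le_max_left k l) hA) D
      (selectBelow_mono G (le_max_right k l) hD) with h | h | h | h
    · exact ⟨A, D, hA', hD', h⟩
    · exact ⟨A, Dᶜ, hA', hD'.compl, h⟩
    · exact ⟨Aᶜ, D, hA'.compl, hD', h⟩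
    · exact ⟨Aᶜ, Dᶜ, hA'.compl, hD'.compl, h⟩

end Selection

/-! ### Invariance under isomorphisms -/

section Invariance

variable {V W : Type u} {G : SimpleGraph V} {H : SimpleGraph W} (φ : G ≃g H)

/-- The image of a ray under an isomorphism. -/
def Ray.map (R : Ray G) : Ray H where
  vertex n := φ (R.vertex n)
  injective := φ.injective.comp R.injective
  adj n := φ.map_adj_iff.2 (R.adj n)

/-- The map that an isomorphism induces on vertices and rays. -/
def mapPoint : V ⊕ Ray G → W ⊕ Ray H := Sum.map φ (Ray.map φ)

theorem inside_mapPoint {p : V ⊕ Ray G} {A : Set W} :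
    Inside (mapPoint φ p) A ↔ Inside p (φ ⁻¹' A) := by
  cases p <;> rfl

theorem mapPoint_surjective : Function.Surjective (mapPoint φ) := by
  rintro (w | R)
  · exact ⟨Sum.inl (φ.symm w), congrArg Sum.inl (φ.apply_symm_apply w)⟩
  · refine ⟨Sum.inr (R.map φ.symm), congrArg Sum.inr ?_⟩
    obtain ⟨f, hf, h⟩ := R
    simp only [Ray.map, Ray.mk.injEq]
    exact funext fun n => φ.apply_symm_apply _

theorem image_cut_preimage (A : Set W) : Sym2.map φ '' cut G (φ ⁻¹' A) = cut H A := by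
  ext e
  constructor
  · rintro ⟨f, hf, rfl⟩
    induction f with
    | _ a b =>
      rw [Sym2.map_mk, mem_cut]
      rw [mem_cut] at hf
      exact ⟨φ.map_adj_iff.2 hf.1, hf.2⟩
  · induction e with
    | _ a b =>
      intro h
      rw [mem_cut] at h
      refine ⟨s(φ.symm a, φ.symm b), mem_cut.2 ⟨φ.symm.map_adj_iff.2 h.1, ?_⟩, ?_⟩
      · simpa using h.2
      · simp

theorem encard_cut_preimage (A : Set W) : (cut G (φ ⁻¹' A)).encard = (cut H A).encard := by
  rw [← image_cut_preimage φ A, (Sym2.map.injective φ.injective).encard_image]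

theorem finite_cut_preimage {A : Set W} : (cut G (φ ⁻¹' A)).Finite ↔ (cut H A).Finite := by
  rw [← Set.encard_lt_top_iff, encard_cut_preimage, Set.encard_lt_top_iff]

theorem eff_preimage {p q : V ⊕ Ray G} {A : Set W} :
    Eff p q (φ ⁻¹' A) ↔ Eff (mapPoint φ p) (mapPoint φ q) A := by
  have hsep : ∀ B : Set W, Sep (mapPoint φ p) (mapPoint φ q) B ↔ Sep p q (φ ⁻¹' B) := by
    intro B
    unfold Sep
    rw [inside_mapPoint, inside_mapPoint]
  constructor
  · intro h
    refine ⟨(finite_cut_preimage φ).1 h.finite, (hsep A).2 h.sep, fun B hB hs => ?_⟩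
    have := h.le _ ((finite_cut_preimage φ).2 hB) ((hsep B).1 hs)
    rwa [encard_cut_preimage, encard_cut_preimage] at this
  · intro h
    refine ⟨(finite_cut_preimage φ).2 h.finite, (hsep A).1 h.sep, fun B hB hs => ?_⟩
    obtain ⟨B, rfl⟩ := φ.injective.preimage_surjective B
    have := h.le _ ((finite_cut_preimage φ).1 hB) ((hsep B).2 hs)
    rwa [encard_cut_preimage, encard_cut_preimage]

theorem nestedSides_preimage {A D : Set W} :
    NestedSides (φ ⁻¹' A) (φ ⁻¹' D) ↔ NestedSides A D := by
  unfold NestedSides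
  simp only [← Set.preimage_compl, φ.surjective.preimage_subset_preimage_iff]

variable {k : ℕ} {prev : Set (Set V)} {prev' : Set (Set W)}

theorem candidate_preimage (hprev : ∀ D, φ ⁻¹' D ∈ prev ↔ D ∈ prev') {p q : V ⊕ Ray G}
    {A : Set W} : Candidate k prev p q (φ ⁻¹' A) ↔
      Candidate k prev' (mapPoint φ p) (mapPoint φ q) A := by
  constructor
  · intro h
    refine ⟨(eff_preimage φ).1 h.eff, by rw [← encard_cut_preimage φ, h.order], fun D hD => ?_⟩
    exact (nestedSides_preimage φ).1 (h.nested _ ((hprev D).2 hD))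
  · intro h
    refine ⟨(eff_preimage φ).2 h.eff, by rw [encard_cut_preimage φ, h.order], fun D hD => ?_⟩
    obtain ⟨D, rfl⟩ := φ.injective.preimage_surjective D
    exact (nestedSides_preimage φ).2 (h.nested _ ((hprev D).1 hD))

theorem ncard_crossing_preimage (hprev : ∀ D, φ ⁻¹' D ∈ prev ↔ D ∈ prev') (A : Set W) :
    (crossing G k prev (φ ⁻¹' A)).ncard = (crossing H k prev' A).ncard := by
  rw [← Set.ncard_image_of_injective (crossing H k prev' A) φ.surjective.preimage_injective]
  congr 1
  ext D
  obtain ⟨D, rfl⟩ := φ.injective.preimage_surjective D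
  rw [φ.surjective.preimage_injective.mem_set_image]
  simp only [crossing, Set.mem_ofPred_eq, nestedSides_preimage, candidate_preimage φ hprev,
    (mapPoint_surjective φ).exists]

theorem select_preimage (hprev : ∀ D, φ ⁻¹' D ∈ prev ↔ D ∈ prev') (A : Set W) :
    φ ⁻¹' A ∈ select G k prev ↔ A ∈ select H k prev' := by
  simp only [select, Set.mem_ofPred_eq, candidate_preimage φ hprev,
    (mapPoint_surjective φ).exists, φ.injective.preimage_surjective.forall,
    ncard_crossing_preimage φ hprev]

theorem selectBelow_preimage (k : ℕ) (A : Set W) :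
    φ ⁻¹' A ∈ selectBelow G k ↔ A ∈ selectBelow H k := by
  induction k generalizing A with
  | zero => rfl
  | succ k ih => exact or_congr (ih A) (select_preimage φ ih A)

theorem mapCuts_canonicalBonds : mapCuts φ (canonicalBonds G) = canonicalBonds H := by
  ext F
  constructor
  · rintro ⟨_, ⟨k, A, hA, rfl⟩, rfl⟩
    obtain ⟨A, rfl⟩ := φ.injective.preimage_surjective A
    exact ⟨k, A, (selectBelow_preimage φ k A).1 hA, (image_cut_preimage φ A).symm⟩
  · rintro ⟨k, A, hA, rfl⟩
    exact ⟨_, ⟨k, _, (selectBelow_preimage φ k A).2 hA, rfl⟩, image_cut_preimage φ A⟩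

end Invariance

end EdgeBlocks
namespace EdgeBlocks

/-! ### Edge-blocks and finite cuts -/

section BlocksAndCuts

variable {V : Type u} {G : SimpleGraph V} {F : Set (Sym2 V)} {A : Set V} {x y z : Point G}
  {k l : ℕ∞} {β β' : Set (Point G)}

/-- The vertex itself, or a ray in the end. -/
noncomputable def representative (x : Point G) : V ⊕ Ray G := Sum.map id Quotient.out x

/-- Ends are defined by deleting vertices. Deleting the finitely many endpoints of `F` leaves a
subgraph of `G - F`, so equivalent rays end up in the same component of `G - F`, and any
representative of an end may be used. -/
theorem Ray.Equivalent.inside {R R' : Ray G} (h : R.Equivalent R') (hF : F.Finite)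
    {C : (G.deleteEdges F).ConnectedComponent} (hR : Inside (Sum.inr R) C.supp) :
    Inside (Sum.inr R') C.supp := by
  obtain ⟨K, ⟨n, hn⟩, ⟨m, hm⟩⟩ := h {z | ∃ e ∈ F, z ∈ e} (finite_endpoints hF)
  obtain ⟨n', hn'⟩ := Filter.eventually_atTop.1 hR
  refine Filter.eventually_atTop.2 ⟨m, fun j hj => ?_⟩
  obtain ⟨h₁, h₁'⟩ := hn (max n n') (le_max_left _ _)
  obtain ⟨h₂, h₂'⟩ := hm j hj
  have hC := hn' (max n n') (le_max_right _ _)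
  have hreach : (G.induce {z | ∃ e ∈ F, z ∈ e}ᶜ).Reachable ⟨_, h₁⟩ ⟨_, h₂⟩ :=
    SimpleGraph.ConnectedComponent.exact (h₁'.trans h₂'.symm)
  let f : G.induce {z | ∃ e ∈ F, z ∈ e}ᶜ →g G.deleteEdges F :=
    { toFun := Subtype.val
      map_rel' := by
        rintro ⟨a, ha⟩ ⟨b, hb⟩ hab
        rw [SimpleGraph.deleteEdges_adj]
        exact ⟨hab, fun he => ha ⟨_, he, Sym2.mem_mk_left _ _⟩⟩ }
  have hreach' := hreach.map f
  rw [SimpleGraph.ConnectedComponent.mem_supp_iff] at hC ⊢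
  rw [← hC]
  exact SimpleGraph.ConnectedComponent.sound hreach'.symm

theorem LivesIn.inside {C : (G.deleteEdges F).ConnectedComponent} {X : Set (Point G)}
    (h : LivesIn G F X C) (hx : x ∈ X) : Inside (representative x) C.supp := by
  cases x with
  | inl v => exact h.1 v hx
  | inr ε =>
    have hε : (Quotient.out ε).toEnd = ε := Quotient.out_eq ε
    obtain ⟨n, hn⟩ := h.2 (Quotient.out ε) (by rwa [hε])
    exact Filter.eventually_atTop.2 ⟨n, fun i hi => (hn i hi).1⟩

theorem livesIn_of_inside (hF : F.Finite) {C : (G.deleteEdges F).ConnectedComponent}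
    {X : Set (Point G)} (h : ∀ x ∈ X, Inside (representative x) C.supp) : LivesIn G F X C := by
  refine ⟨fun v hv => h _ hv, fun R hR => ?_⟩
  have heq : (Quotient.out R.toEnd).Equivalent R := Quotient.exact (Quotient.out_eq R.toEnd)
  have h₁ : Inside (Sum.inr R) C.supp := heq.inside hF (h _ hR)
  obtain ⟨n, hn⟩ := Filter.eventually_atTop.1
    (Filter.Eventually.and h₁ (R.eventually_edge_notMem hF))
  refine ⟨n, fun i hi => ⟨(hn i hi).1, ?_⟩⟩
  rw [SimpleGraph.deleteEdges_adj]
  exact ⟨R.adj i, (hn i hi).2⟩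

theorem exists_inside_component (hF : F.Finite) (p : V ⊕ Ray G) :
    ∃ C : (G.deleteEdges F).ConnectedComponent, Inside p C.supp := by
  cases p with
  | inl v => exact ⟨(G.deleteEdges F).connectedComponentMk v, rfl⟩
  | inr R =>
    obtain ⟨m, hm⟩ := Filter.eventually_atTop.1 (R.eventually_edge_notMem hF)
    refine ⟨(G.deleteEdges F).connectedComponentMk (R.vertex m),
      Filter.eventually_atTop.2 ⟨m, fun n hn => ?_⟩⟩
    rw [SimpleGraph.ConnectedComponent.mem_supp_iff]
    induction n, hn using Nat.le_induction with
    | base => rfl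
    | succ n hn ih =>
      rw [← ih]
      have hadj : (G.deleteEdges F).Adj (R.vertex n) (R.vertex (n + 1)) := by
        rw [SimpleGraph.deleteEdges_adj]
        exact ⟨R.adj n, hm n hn⟩
      exact SimpleGraph.ConnectedComponent.sound hadj.reachable.symm

theorem cut_supp_subset (C : (G.deleteEdges F).ConnectedComponent) : cut G C.supp ⊆ F := by
  intro e
  induction e with
  | _ a b =>
    intro h
    obtain ⟨hab, hne⟩ := mem_cut.1 h
    by_contra he
    have hadj : (G.deleteEdges F).Adj a b := by
      rw [SimpleGraph.deleteEdges_adj]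
      exact ⟨hab, he⟩
    exact hne (SimpleGraph.ConnectedComponent.mem_supp_congr_adj C hadj)

theorem Distinguishes.mono {X Y X' Y' : Set (Point G)} (h : Distinguishes G F X Y) (hX : X' ⊆ X)
    (hY : Y' ⊆ Y) : Distinguishes G F X' Y' := by
  obtain ⟨hF, C, D, hCD, hC, hD⟩ := h
  exact ⟨hF, C, D, hCD, ⟨fun v hv => hC.1 v (hX hv), fun R hR => hC.2 R (hX hR)⟩,
    ⟨fun v hv => hD.1 v (hY hv), fun R hR => hD.2 R (hY hR)⟩⟩

theorem Distinguishes.exists_sep {X Y : Set (Point G)} (h : Distinguishes G F X Y) (hx : x ∈ X)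
    (hy : y ∈ Y) : ∃ A, cut G A ⊆ F ∧ Sep (representative x) (representative y) A := by
  obtain ⟨-, C, D, hCD, hC, hD⟩ := h
  refine ⟨C.supp, cut_supp_subset C, fun hiff => ?_⟩
  have h₁ := hiff.1 (hC.inside hx)
  refine not_inside_empty (p := representative y) ((inside_inter.2 ⟨h₁, hD.inside hy⟩).mono ?_)
  rintro v ⟨hv, hv'⟩
  exact hCD (hv.symm.trans hv')

theorem component_ne_of_sep (hA : cut G A ⊆ F) {p q : V ⊕ Ray G} (hs : Sep p q A)
    {C D : (G.deleteEdges F).ConnectedComponent} (hC : Inside p C.supp) (hD : Inside q D.supp) :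
    C ≠ D := by
  rintro rfl
  have hside : ∀ a ∈ C.supp, ∀ b ∈ C.supp, a ∈ A → b ∈ A := by
    intro a ha b hb haA
    by_contra hbA
    have hreach : (G.deleteEdges F).Reachable a b :=
      SimpleGraph.ConnectedComponent.exact (ha.trans hb.symm)
    obtain ⟨a', ha', b', hb', hab⟩ := exists_adj_of_reachable hreach haA hbA
    rw [SimpleGraph.deleteEdges_adj] at hab
    exact hab.2 (hA (mem_cut.2 ⟨hab.1, fun h => hb' (h.1 ha')⟩))
  by_cases h : ∃ a ∈ C.supp, a ∈ A
  · obtain ⟨a, ha, haA⟩ := h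
    have hsub : C.supp ⊆ A := fun b hb => hside a ha b hb haA
    exact hs (iff_of_true (hC.mono hsub) (hD.mono hsub))
  · push Not at h
    have hemp : C.supp ∩ A ⊆ ∅ := fun a ha => h a ha.1 ha.2
    exact hs (iff_of_false (fun h' => not_inside_empty ((inside_inter.2 ⟨hC, h'⟩).mono hemp))
      (fun h' => not_inside_empty ((inside_inter.2 ⟨hD, h'⟩).mono hemp)))

/-- Distinguishing edge sets may be replaced by cuts: the boundary of a component of `G - F` lies in
`F`, and conversely no component left by deleting the cut of `A` meets both sides of `A`. -/
theorem inseparable_iff : Inseparable G k x y ↔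
    ∀ A, (cut G A).encard < k → ¬ Sep (representative x) (representative y) A := by
  constructor
  · intro h A hA hs
    have hfin : (cut G A).Finite := Set.encard_lt_top_iff.1 (hA.trans_le le_top)
    obtain ⟨C, hC⟩ := exists_inside_component hfin (representative x)
    obtain ⟨D, hD⟩ := exists_inside_component hfin (representative y)
    refine h _ hA ⟨cut_subset_edgeSet, C, D, component_ne_of_sep subset_rfl hs hC hD,
      livesIn_of_inside hfin ?_, livesIn_of_inside hfin ?_⟩
    · rintro _ rfl
      exact hC
    · rintro _ rfl
      exact hD
  · intro h F hF hd
    obtain ⟨A, hA, hs⟩ := hd.exists_sep (Set.mem_singleton x) (Set.mem_singleton y)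
    exact h A ((Set.encard_le_encard hA).trans_lt hF) hs

theorem Inseparable.refl (k : ℕ∞) (x : Point G) : Inseparable G k x x :=
  inseparable_iff.2 fun _ _ h => h Iff.rfl

theorem Inseparable.symm (h : Inseparable G k x y) : Inseparable G k y x :=
  inseparable_iff.2 fun A hA hs => inseparable_iff.1 h A hA fun hs' => hs hs'.symm

theorem Inseparable.trans (h : Inseparable G k x y) (h' : Inseparable G k y z) :
    Inseparable G k x z := by
  refine inseparable_iff.2 fun A hA hs => ?_
  have h₁ := inseparable_iff.1 h A hA
  have h₂ := inseparable_iff.1 h' A hA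
  unfold Sep at *
  tauto

theorem IsKEdgeBlock.eq (hβ : IsKEdgeBlock G k β) (hx : x ∈ β) :
    β = {y | Inseparable G k x y} := by
  obtain ⟨z, rfl⟩ := hβ
  ext y
  exact ⟨fun h => (Inseparable.symm hx).trans h, fun h => Inseparable.trans hx h⟩

theorem livesIn_block (hβ : IsKEdgeBlock G k β) (hx : x ∈ β) (hA : (cut G A).encard < k)
    {C : (G.deleteEdges (cut G A)).ConnectedComponent}
    (hC : Inside (representative x) C.supp) : LivesIn G (cut G A) β C := by
  have hfin : (cut G A).Finite := Set.encard_lt_top_iff.1 (hA.trans_le le_top)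
  refine livesIn_of_inside hfin fun y hy => ?_
  rw [hβ.eq hx] at hy
  have hCk := (Set.encard_le_encard (cut_supp_subset C)).trans_lt hA
  by_contra hyC
  exact inseparable_iff.1 hy C.supp hCk fun hiff => hyC (hiff.1 hC)

theorem distinguishes_blocks (hβ : IsKEdgeBlock G k β) (hβ' : IsKEdgeBlock G l β') (hx : x ∈ β)
    (hy : y ∈ β') (hk : (cut G A).encard < k) (hl : (cut G A).encard < l)
    (hs : Sep (representative x) (representative y) A) : Distinguishes G (cut G A) β β' := by
  have hfin : (cut G A).Finite := Set.encard_lt_top_iff.1 (hk.trans_le le_top)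
  obtain ⟨C, hC⟩ := exists_inside_component hfin (representative x)
  obtain ⟨D, hD⟩ := exists_inside_component hfin (representative y)
  exact ⟨cut_subset_edgeSet, C, D, component_ne_of_sep subset_rfl hs hC hD,
    livesIn_block hβ hx hk hC, livesIn_block hβ' hy hl hD⟩

theorem exists_eff {p q : V ⊕ Ray G} (hA : (cut G A).Finite) (hs : Sep p q A) :
    ∃ B, Eff p q B := by
  obtain ⟨n, hn⟩ := ENat.ne_top_iff_exists.1 (Set.encard_ne_top_iff.2 hA)
  induction n using Nat.strong_induction_on generalizing A with
  | _ n ih =>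
    by_cases hmin : ∀ B, (cut G B).Finite → Sep p q B → (cut G A).encard ≤ (cut G B).encard
    · exact ⟨A, hA, hs, hmin⟩
    · push Not at hmin
      obtain ⟨B, hB, hBs, hlt⟩ := hmin
      obtain ⟨m, hm⟩ := ENat.ne_top_iff_exists.1 (Set.encard_ne_top_iff.2 hB)
      rw [← hn, ← hm] at hlt
      exact ih m (by exact_mod_cast hlt) hB hBs hm

theorem efficientlyDistinguishes_canonicalBonds (hG : G.Connected) :
    EfficientlyDistinguishesEdgeBlocks G (canonicalBonds G) := by
  rintro β β' ⟨k, hβ⟩ ⟨l, hβ'⟩ hdisj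
  obtain ⟨x, hx⟩ := id hβ
  obtain ⟨y, hy⟩ := id hβ'
  have hxβ : x ∈ β := by rw [hx]; exact Inseparable.refl k x
  have hyβ : y ∈ β' := by rw [hy]; exact Inseparable.refl l y
  have hsep : ∃ A, (cut G A).encard < k ∧ (cut G A).encard < l ∧
      Sep (representative x) (representative y) A := by
    -- The block with the smaller parameter does not contain the representative of the other, so `x`
    -- and `y` are separated by fewer than `min k l` edges.
    rcases le_total k l with hkl | hlk
    · have h : ¬ Inseparable G k x y := fun h =>
        Set.disjoint_left.1 hdisj (by rw [hx]; exact h) hyβ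
      rw [inseparable_iff] at h
      push Not at h
      obtain ⟨A, hA, hs⟩ := h
      exact ⟨A, hA, hA.trans_le hkl, hs⟩
    · have h : ¬ Inseparable G l x y := fun h =>
        Set.disjoint_left.1 hdisj hxβ (by rw [hy]; exact Inseparable.symm h)
      rw [inseparable_iff] at h
      push Not at h
      obtain ⟨A, hA, hs⟩ := h
      exact ⟨A, hA.trans_le hlk, hA, hs⟩
  obtain ⟨A, hk, hl, hs⟩ := hsep
  have hfin : (cut G A).Finite := Set.encard_lt_top_iff.1 (hk.trans_le le_top)
  obtain ⟨A', hA'⟩ := exists_eff hfin hs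
  obtain ⟨n, B, hB, hBe⟩ := exists_mem_selectBelow hG hA'
  have hle := hBe.le A hfin hs
  refine ⟨cut G B, ⟨n, B, hB, rfl⟩,
    distinguishes_blocks hβ hβ' hxβ hyβ (hle.trans_lt hk) (hle.trans_lt hl) hBe.sep, ?_⟩
  intro F' hF'
  by_cases hfin' : F'.Finite
  · obtain ⟨D, hD, hDs⟩ := hF'.exists_sep hxβ hyβ
    exact (hBe.le D (hfin'.subset hD) hDs).trans (Set.encard_le_encard hD)
  · rw [Set.Infinite.encard_eq hfin']
    exact le_top

/-- Separable vertices have disjoint `k`-edge-blocks, so `N` contains an efficient distinguisher of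
these blocks. The remaining points are that its order is less than `k` and that its two sides really
separate the vertices. -/
theorem inseparable_vertices_iff (hG : G.Connected) {N : Set (Set (Sym2 V))}
    (hN : IsNestedSetOfBonds G N) (hN' : EfficientlyDistinguishesEdgeBlocks G N) (k : ℕ)
    (v w : V) : Inseparable G k (Sum.inl v) (Sum.inl w) ↔
      ∀ A ∈ sides G (orderLT N k), v ∈ A ↔ w ∈ A := by
  constructor
  · rintro h A ⟨F, ⟨-, hFk⟩, hA⟩
    by_contra hne
    refine inseparable_iff.1 h A ?_ hne
    rwa [cut, ← hA.2.2]
  · intro h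
    by_contra hins
    have hv : IsKEdgeBlock G k {y | Inseparable G k (Sum.inl v) y} := ⟨_, rfl⟩
    have hw : IsKEdgeBlock G k {y | Inseparable G k (Sum.inl w) y} := ⟨_, rfl⟩
    have hvm := Inseparable.refl (G := G) k (Sum.inl v)
    have hwm := Inseparable.refl (G := G) k (Sum.inl w)
    obtain ⟨F, hF, hFd, hFe⟩ := hN' _ _ ⟨k, hv⟩ ⟨k, hw⟩ (Set.disjoint_left.2 fun y hy hy' =>
      hins (Inseparable.trans hy (Inseparable.symm hy')))
    rw [inseparable_iff] at hins
    push Not at hins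
    obtain ⟨A, hA, hs⟩ := hins
    -- A cut of order less than `k` that separates `v` from `w` distinguishes their whole blocks, so
    -- efficiency bounds `F`.
    have hFk : F.encard < k := (hFe _ (distinguishes_blocks hv hw hvm hwm hA hA hs)).trans_lt hA
    obtain ⟨D, hD, hDs⟩ := hFd.exists_sep hvm hwm
    obtain ⟨B, hB, -⟩ := hN.1 F hF
    have hlink := (hN.1 F hF).isBondSide hG hB
    have hvw := h B ⟨F, ⟨hF, hFk⟩, hB⟩
    have hFB : F = cut G B := hB.2.2
    rw [hFB] at hD
    -- The sides of the bond `F` are linked without using edges of `F`, so a set `D` with boundary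
    -- in `F` cannot split either of them; hence `v` and `w` lie on different sides.
    have key : ∀ C : Set V, Linked G C → (∀ a ∈ C, ∀ b ∈ C, (a ∈ B ↔ b ∈ B)) →
        ∀ a ∈ C, ∀ b ∈ C, a ∈ D → b ∈ D := by
      intro C hC hCB a ha b hb haD
      by_contra hbD
      obtain ⟨a', ha', b', hb', hab⟩ := hC D ⟨a, ha, haD⟩ ⟨b, hb, hbD⟩
      exact (mem_cut.1 (hD (mem_cut.2 ⟨hab, fun h => hb'.2 (h.1 ha'.2)⟩))).2
        (hCB a' ha'.1 b' hb'.1)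
    have key' : ∀ C : Set V, Linked G C → (∀ a ∈ C, ∀ b ∈ C, (a ∈ B ↔ b ∈ B)) →
        v ∈ C → w ∈ C → False := fun C hC hCB hv hw =>
      hDs ⟨key C hC hCB v hv w hw, key C hC hCB w hw v hv⟩
    by_cases hvB : v ∈ B
    · exact key' B hlink.linked (fun a ha b hb => iff_of_true ha hb) hvB (hvw.1 hvB)
    · exact key' Bᶜ hlink.linked_compl (fun a ha b hb => iff_of_false ha hb) hvB
        (fun hw => hvB (hvw.2 hw))

theorem exists_decomposition_into_edgeBlocks (hG : G.Connected) {N : Set (Set (Sym2 V))}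
    (hN : IsNestedSetOfBonds G N) (hN' : EfficientlyDistinguishesEdgeBlocks G N) (k : ℕ) :
    ∃ D : TreeCutDecomposition G,
      D.fundamentalCuts = orderLT N k ∧ D.DecomposesIntoKEdgeBlocks k := by
  obtain ⟨D, hD, hparts⟩ := exists_treeCutDecomposition hG (k := k) (B := orderLT N k)
    ⟨fun F hF => hN.1 F hF.1, fun F hF F' hF' => hN.2 F hF.1 F' hF'.1⟩ (fun F hF => hF.2)
  refine ⟨D, hD, ?_⟩
  rintro P ⟨v, hv⟩
  rw [hparts P v hv]
  have hset : {w | ∀ A ∈ sides G (orderLT N k), v ∈ A ↔ w ∈ A} =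
      {w : V | Inseparable G k (Sum.inl v) (Sum.inl w)} :=
    Set.ext fun w => (inseparable_vertices_iff hG hN hN' k v w).symm
  rw [hset]
  constructor
  · rintro rfl
    exact ⟨{y | Inseparable G k (Sum.inl v) y}, ⟨_, rfl⟩, rfl⟩
  · rintro ⟨β, hβ, rfl⟩
    rw [hβ.eq hv]
    rfl

end BlocksAndCuts

end EdgeBlocks

theorem theorem4p3 :
    (∀ (V : Type u) (G : SimpleGraph V), G.Connected → ∀ (k : ℕ) (B : Set (Set (Sym2 V))),
      EdgeBlocks.IsNestedSetOfBonds G B → (∀ F ∈ B, F.encard < k) →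
        ∃ D : EdgeBlocks.TreeCutDecomposition G, D.fundamentalCuts = B) ∧
    (∀ (V : Type u) (G : SimpleGraph V), G.Connected → ∀ N : Set (Set (Sym2 V)),
      EdgeBlocks.IsNestedSetOfBonds G N → EdgeBlocks.EfficientlyDistinguishesEdgeBlocks G N →
        ∀ k : ℕ, ∃ D : EdgeBlocks.TreeCutDecomposition G,
          D.fundamentalCuts = EdgeBlocks.orderLT N k ∧ D.DecomposesIntoKEdgeBlocks k) ∧
    (∃ N : (V : Type u) → SimpleGraph V → Set (Set (Sym2 V)),
      (∀ (V W : Type u) (G : SimpleGraph V) (H : SimpleGraph W) (φ : G ≃g H), G.Connected →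
        EdgeBlocks.mapCuts φ (N V G) = N W H) ∧
      ∀ (V : Type u) (G : SimpleGraph V), G.Connected →
        EdgeBlocks.IsNestedSetOfBonds G (N V G) ∧
        EdgeBlocks.EfficientlyDistinguishesEdgeBlocks G (N V G) ∧
        ∀ k : ℕ, ∃ D : EdgeBlocks.TreeCutDecomposition G,
          D.fundamentalCuts = EdgeBlocks.orderLT (N V G) k ∧ D.DecomposesIntoKEdgeBlocks k) := by
  refine ⟨fun V G hG k B hB hk => ?_,
    fun V G hG N hN hN' k => EdgeBlocks.exists_decomposition_into_edgeBlocks hG hN hN' k,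
    fun V G => EdgeBlocks.canonicalBonds G,
    fun V W G H φ _ => EdgeBlocks.mapCuts_canonicalBonds φ, fun V G hG => ?_⟩
  · obtain ⟨D, hD, -⟩ := EdgeBlocks.exists_treeCutDecomposition hG hB hk
    exact ⟨D, hD⟩
  · have hN := EdgeBlocks.isNestedSetOfBonds_canonicalBonds hG
    have hN' := EdgeBlocks.efficientlyDistinguishes_canonicalBonds hG
    exact ⟨hN, hN', EdgeBlocks.exists_decomposition_into_edgeBlocks hG hN hN'⟩
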